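/- Let $\Bbbk$ be a field, $n\ge 0$ and $\sigma\in S_n$ a permutation of $\{1,\dots,n\}$. Choose any decomposition $$\sigma=(x_{11}\ x_{12}\cdots x_{1,t(1)})\cdots(x_{m1}\ x_{m2}\cdots x_{m,t(m)})$$ into disjoint cycles, in any order and including the cycles of length $1$, so that every element of $\{1,\dots,n\}$ is exactly one $x_{ij}$; read the index $j$ of $x_{ij}$ modulo $t(i)$. Let $Q$ be the quiver with vertex set $\{1,\dots,n\}$ and the following arrows, for $1\le i\le m-1$, $1\le j\le t(i)$, $1\le l\le t(i+1)$: one arrow $\alpha_{ijl}\colon x_{ij}\to x_{i+1,l}$ if $i$ is odd, and one arrow $\beta_{ijl}\colon x_{i+1,l}\to x_{ij}$ if $i$ is even. Then $\sigma$ extends uniquely to an automorphism of $Q$, and hence to an automorphism $\sigma$ of the path algebra $\Bbbk Q$, regarded as a $\Bbbk$-linear category $C$ with object set $\{1,\dots,n\}$. Let $D=\operatorname{Hom}_\Bbbk(-,\Bbbk)$ and let $\hat C$ be the repetition of $C$: its objects are $x^{[i]}$ ($x\in C$, $i\in\mathbb Z$), its morphism spaces are $\hat C(x^{[i]},y^{[i]})=C(x,y)$,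 $\hat C(x^{[i]},y^{[i+1]})=D\,C(y,x)$, and $\hat C(x^{[i]},y^{[j]})=0$ otherwise, and the composition is given by that of $C$, the bimodule structure of $DC$, and zero on pairs of morphisms in $DC$. Let $\hat\sigma$ be the automorphism of $\hat C$ induced by $\sigma$ (with $\hat\sigma(x^{[i]})=(\sigma x)^{[i]}$), and let $\nu$ be the Nakayama automorphism of $\hat C$, $\nu(x^{[i]})=x^{[i+1]}$. For an automorphism $F=\nu^{\pm1}\hat\sigma$ let $\hat C/\langle F\rangle$ denote the algebra of the orbit category, that is, the algebra of all row and column finite matrices $(f_{q,p}\in\hat C(p,q))_{p,q\in\hat C}$ with $f_{Fq,Fp}=F(f_{q,p})$ for all $p,q$, and let $e_x$ be its idempotent given by the identities of the objects in the orbit of $x^{[0]}$. **Theorem.** Let $A=T^1_\sigma(\Bbbk Q)=\hat C/\langle\nu\hat\sigma\rangle$ be the twisted $1$-fold extension of $\Bbbk Q$ by $\sigma$. Then $A$ is a (finite-dimensional) self-injective algebra with $(\operatorname{rad}A)^3=0$; the elements $e_1,\dots,e_n$ form a complete system of orthogonal primitive idempotents of $A$ with pairwise nonisomorphic projective modules;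 and $\sigma$ is the Nakayama permutation of $A$: $$\operatorname{soc}(e_xA)\cong\operatorname{top}(e_{\sigma(x)}A)\quad\text{as right $A$-modules, for all }x\in\{1,\dots,n\}.$$ The same holds with left modules in place of right modules, if $\nu$ is replaced by the Nakayama automorphism for left modules, which is $\nu^{-1}$: for $A'=\hat C/\langle\nu^{-1}\hat\sigma\rangle$, the algebra $A'$ is finite-dimensional and self-injective, $(\operatorname{rad}A')^3=0$, the elements $e_1,\dots,e_n$ of $A'$ form a complete system of orthogonal primitive idempotents with pairwise nonisomorphic projective modules, and $\operatorname{soc}(A'e_x)\cong\operatorname{top}(A'e_{\sigma(x)})$ as left $A'$-modules, for all $x$. -/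

import Mathlib

open CategoryTheory

universe u v w

namespace TwistedExt

/-! ### Automorphisms of linear categories -/

section LinearAut

variable (k : Type u) [Field k] (C : Type w) [Category.{v} C] [Preadditive C] [Linear k C]

/-- An automorphism of a `k`-linear category (not an auto-equivalence up to isomorphism):
a `k`-linear functor that is bijective on objects and on every space of morphisms. -/
structure LinearAut where
  functor : C ⥤ C
  map_add : ∀ {X Y : C} (f g : X ⟶ Y), functor.map (f + g) = functor.map f + functor.map g
  map_smul : ∀ {X Y : C} (c : k) (f : X ⟶ Y), functor.map (c • f) = c • functor.map f
  obj_bijective : Function.Bijective functor.obj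
  map_bijective : ∀ X Y : C, Function.Bijective (functor.map : (X ⟶ Y) → _)

variable {k C}

/-- The composite automorphism: first `F`, then `G`. -/
def LinearAut.comp (F G : LinearAut k C) : LinearAut k C where
  functor := F.functor ⋙ G.functor
  map_add f g := by simp [F.map_add, G.map_add]
  map_smul c f := by simp [F.map_smul, G.map_smul]
  obj_bijective := G.obj_bijective.comp F.obj_bijective
  map_bijective X Y := (G.map_bijective _ _).comp (F.map_bijective X Y)

/-- The action of an automorphism on morphisms, as a linear isomorphism. -/
noncomputable def LinearAut.homEquiv (F : LinearAut k C) (X Y : C) :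
    (X ⟶ Y) ≃ₗ[k] (F.functor.obj X ⟶ F.functor.obj Y) :=
  LinearEquiv.ofBijective
    { toFun := F.functor.map, map_add' := F.map_add, map_smul' := F.map_smul }
    (F.map_bijective X Y)

theorem LinearAut.homEquiv_apply (F : LinearAut k C) {X Y : C} (f : X ⟶ Y) :
    F.homEquiv X Y f = F.functor.map f := rfl

theorem LinearAut.map_zero (F : LinearAut k C) (X Y : C) :
    F.functor.map (0 : X ⟶ Y) = 0 := (F.homEquiv X Y).map_zero

end LinearAut

/-! ### The orbit algebra of a linear category by a cyclic group of automorphisms -/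

section Orbit

variable {k : Type u} [Field k] {C : Type w} [Category.{v} C] [Preadditive C] [Linear k C]

/-- The matrices `f = (f p q : p ⟶ q)`, indexed by pairs of objects of `C`, which are row finite
and column finite and invariant under the group generated by the automorphism `F`
(equivalently: under `F`). -/
def orbitSubmodule (F : LinearAut k C) : Submodule k (∀ p q : C, (p ⟶ q)) where
  carrier := {f | (∀ p, {q | f p q ≠ 0}.Finite) ∧ (∀ q, {p | f p q ≠ 0}.Finite) ∧
    ∀ p q, f (F.functor.obj p) (F.functor.obj q) = F.functor.map (f p q)}
  add_mem' := by
    rintro f g ⟨hf1, hf2, hf3⟩ ⟨hg1, hg2, hg3⟩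
    refine ⟨fun p => ((hf1 p).union (hg1 p)).subset fun q hq => ?_,
      fun q => ((hf2 q).union (hg2 q)).subset fun p hp => ?_, fun p q => ?_⟩
    · by_contra hc
      simp only [Set.mem_union, Set.mem_ofPred_eq, not_or, not_not] at hc
      exact hq (by simp [hc.1, hc.2])
    · by_contra hc
      simp only [Set.mem_union, Set.mem_ofPred_eq, not_or, not_not] at hc
      exact hp (by simp [hc.1, hc.2])
    · simp [hf3, hg3, F.map_add]
  zero_mem' := by
    refine ⟨fun p => by simp, fun p => by simp, fun p q => ?_⟩
    simp [F.map_zero]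
  smul_mem' := by
    rintro c f ⟨hf1, hf2, hf3⟩
    refine ⟨fun p => (hf1 p).subset fun q hq => ?_,
      fun q => (hf2 q).subset fun p hp => ?_, fun p q => ?_⟩
    · intro h0
      exact hq (by simp [h0])
    · intro h0
      exact hp (by simp [h0])
    · simp [hf3, F.map_smul]

/-- The algebra of the orbit category `C / ⟨F⟩` whose objects are the `⟨F⟩`-orbits of objects of
`C` (for a free action with finitely many orbits): the morphisms from an orbit `a` to an orbit `b`
are the `⟨F⟩`-invariant families `(f p q)` with `p ∈ a`, `q ∈ b`, and the algebra is the direct sum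
of all these spaces of morphisms, with matrix multiplication. -/
def OrbitAlgebra (F : LinearAut k C) : Type (max w v) := orbitSubmodule F

namespace OrbitAlgebra

variable {F : LinearAut k C}

instance : AddCommGroup (OrbitAlgebra F) := inferInstanceAs (AddCommGroup (orbitSubmodule F))
instance : Module k (OrbitAlgebra F) := inferInstanceAs (Module k (orbitSubmodule F))

/-- The entry of a matrix at the pair `(p, q)`, a morphism from `p` to `q`. -/
def entry (f : OrbitAlgebra F) (p q : C) : p ⟶ q := f.1 p q

theorem finite_left (f : OrbitAlgebra F) (p : C) : {q | f.entry p q ≠ 0}.Finite := f.2.1 p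
theorem finite_right (f : OrbitAlgebra F) (q : C) : {p | f.entry p q ≠ 0}.Finite := f.2.2.1 q
theorem entry_map (f : OrbitAlgebra F) (p q : C) :
    f.entry (F.functor.obj p) (F.functor.obj q) = F.functor.map (f.entry p q) := f.2.2.2 p q

@[ext] theorem ext {f g : OrbitAlgebra F} (h : ∀ p q, f.entry p q = g.entry p q) : f = g :=
  Subtype.ext (funext fun p => funext fun q => h p q)

@[simp] theorem entry_add (f g : OrbitAlgebra F) (p q : C) :
    (f + g).entry p q = f.entry p q + g.entry p q := rfl
@[simp] theorem entry_zero (p q : C) : (0 : OrbitAlgebra F).entry p q = 0 := rfl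
@[simp] theorem entry_smul (c : k) (f : OrbitAlgebra F) (p q : C) :
    (c • f).entry p q = c • f.entry p q := rfl

open Classical in
/-- The family of identity morphisms on the objects in an `F`-stable set `S`. -/
noncomputable def idOn (F : LinearAut k C) (S : Set C) (hS : ∀ p, F.functor.obj p ∈ S ↔ p ∈ S) :
    OrbitAlgebra F :=
  ⟨fun p q => if h : p = q then (if p ∈ S then eqToHom h else 0) else 0, by
    refine ⟨fun p => (Set.finite_singleton p).subset fun q hq => ?_,
      fun q => (Set.finite_singleton q).subset fun p hp => ?_, fun p q => ?_⟩
    · by_contra hc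
      exact hq (dif_neg fun h => hc h.symm)
    · by_contra hc
      exact hp (dif_neg fun h => hc h)
    · by_cases h : p = q
      · subst h
        by_cases hp : p ∈ S
        · simp [hp, (hS p).2 hp]
        · have hp' : F.functor.obj p ∉ S := fun h => hp ((hS p).1 h)
          simp [hp, hp', F.map_zero]
      · have h' : F.functor.obj p ≠ F.functor.obj q := fun e => h (F.obj_bijective.1 e)
        simp [h, h', F.map_zero]⟩

/-- The `⟨F⟩`-orbit of an object. -/
def orbit (F : LinearAut k C) (p : C) : Set C :=
  {q | Relation.EqvGen (fun a b => F.functor.obj a = b) p q}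

/-- The identity of the orbit of `p`, as an element of the orbit algebra. -/
noncomputable def idempotent (F : LinearAut k C) (p : C) : OrbitAlgebra F :=
  idOn F (orbit F p) fun q =>
    ⟨fun h => h.trans _ _ _ (.symm _ _ (.rel q _ rfl)), fun h => h.trans _ _ _ (.rel q _ rfl)⟩

noncomputable instance : One (OrbitAlgebra F) := ⟨idOn F Set.univ fun _ => by simp⟩

open Classical in
theorem entry_one_self (p : C) : (1 : OrbitAlgebra F).entry p p = 𝟙 p := by
  change dite (p = p) _ _ = _
  rw [dif_pos rfl, if_pos (Set.mem_univ p), eqToHom_refl]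

theorem entry_one_ne {p q : C} (h : p ≠ q) : (1 : OrbitAlgebra F).entry p q = 0 :=
  dif_neg h

theorem support_comp_left (g f : OrbitAlgebra F) (p r : C) :
    (Function.support fun q => f.entry p q ≫ g.entry q r) ⊆ {q | f.entry p q ≠ 0} := by
  intro q hq h0
  exact hq (by simp [h0])

/-- Matrix multiplication; as for composition, the right factor is applied first. -/
noncomputable instance : Mul (OrbitAlgebra F) :=
  ⟨fun g f => ⟨fun p r => ∑ᶠ q, f.entry p q ≫ g.entry q r, by
    have key : ∀ p r, (∑ᶠ q, f.entry p q ≫ g.entry q r) ≠ 0 →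
        ∃ q, f.entry p q ≠ 0 ∧ g.entry q r ≠ 0 := by
      intro p r h
      by_contra hc
      push Not at hc
      refine h (finsum_eq_zero_of_forall_eq_zero fun q => ?_)
      by_cases hq : f.entry p q = 0
      · simp [hq]
      · simp [hc q hq]
    refine ⟨fun p => ((f.finite_left p).biUnion fun q _ => g.finite_left q).subset ?_,
      fun r => ((g.finite_right r).biUnion fun q _ => f.finite_right q).subset ?_,
      fun p r => ?_⟩
    · intro r hr
      obtain ⟨q, h1, h2⟩ := key p r hr
      exact Set.mem_biUnion h1 h2
    · intro p hp
      obtain ⟨q, h1, h2⟩ := key p r hp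
      exact Set.mem_biUnion h2 h1
    · have hfin := (f.finite_left p).subset (support_comp_left g f p r)
      have := map_finsum (F.homEquiv p r) hfin
      rw [F.homEquiv_apply] at this
      change (∑ᶠ q, f.entry (F.functor.obj p) q ≫ g.entry q (F.functor.obj r)) = _
      rw [this, ← finsum_comp_equiv (Equiv.ofBijective _ F.obj_bijective)]
      refine finsum_congr fun q => ?_
      rw [F.homEquiv_apply, Functor.map_comp, ← entry_map, ← entry_map]
      rfl⟩⟩

theorem entry_mul (g f : OrbitAlgebra F) (p r : C) :
    (g * f).entry p r = ∑ᶠ q, f.entry p q ≫ g.entry q r := rfl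

theorem entry_mul_eq_sum (g f : OrbitAlgebra F) (p r : C) (s : Finset C)
    (hs : ∀ q, f.entry p q ≠ 0 → q ∈ s) :
    (g * f).entry p r = ∑ q ∈ s, f.entry p q ≫ g.entry q r :=
  finsum_eq_sum_of_support_subset _ fun q hq => hs q (support_comp_left g f p r hq)

noncomputable instance : Ring (OrbitAlgebra F) where
  __ := (inferInstance : AddCommGroup (OrbitAlgebra F))
  mul := (· * ·)
  one := 1
  left_distrib a b c := by
    classical
    ext p r
    rw [entry_add, entry_mul_eq_sum _ _ _ _ ((b.finite_left p).toFinset ∪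
        (c.finite_left p).toFinset), entry_mul_eq_sum a b p r ((b.finite_left p).toFinset ∪
        (c.finite_left p).toFinset), entry_mul_eq_sum a c p r ((b.finite_left p).toFinset ∪
        (c.finite_left p).toFinset), ← Finset.sum_add_distrib]
    · simp [Preadditive.add_comp]
    · intro q h; simp [h]
    · intro q h; simp [h]
    · intro q h
      by_contra hc
      simp only [Finset.mem_union, Set.Finite.mem_toFinset, Set.mem_ofPred_eq, not_or,
        not_not] at hc
      exact h (by simp [hc.1, hc.2])
  right_distrib a b c := by
    ext p r
    have hc : ∀ q, c.entry p q ≠ 0 → q ∈ (c.finite_left p).toFinset := by simp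
    rw [entry_add, entry_mul_eq_sum _ _ _ _ _ hc, entry_mul_eq_sum _ _ _ _ _ hc,
      entry_mul_eq_sum _ _ _ _ _ hc, ← Finset.sum_add_distrib]
    simp [Preadditive.comp_add]
  zero_mul a := by
    ext p r
    rw [entry_mul]
    simp
  mul_zero a := by
    ext p r
    rw [entry_mul]
    simp
  mul_assoc a b c := by
    classical
    ext p r
    let s := (c.finite_left p).toFinset
    let t := s.biUnion fun q => (b.finite_left q).toFinset
    have hs : ∀ q, c.entry p q ≠ 0 → q ∈ s := by simp [s]
    have ht : ∀ q ∈ s, ∀ x, b.entry q x ≠ 0 → x ∈ t := fun q hq x hx =>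
      Finset.mem_biUnion.2 ⟨q, hq, by simpa using hx⟩
    have ht' : ∀ x, (b * c).entry p x ≠ 0 → x ∈ t := by
      intro x hx
      rw [entry_mul_eq_sum _ _ _ _ s hs] at hx
      obtain ⟨q, hq, hne⟩ := Finset.exists_ne_zero_of_sum_ne_zero hx
      exact ht q hq x fun h0 => hne (by simp [h0])
    rw [entry_mul_eq_sum _ _ _ _ s hs, entry_mul_eq_sum _ _ _ _ t ht']
    have h1 : ∀ q ∈ s, c.entry p q ≫ (a * b).entry q r =
        ∑ x ∈ t, c.entry p q ≫ b.entry q x ≫ a.entry x r := fun q hq => by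
      rw [entry_mul_eq_sum _ _ _ _ t (ht q hq), Preadditive.comp_sum]
    have h2 : ∀ x ∈ t, (b * c).entry p x ≫ a.entry x r =
        ∑ q ∈ s, c.entry p q ≫ b.entry q x ≫ a.entry x r := fun x _ => by
      rw [entry_mul_eq_sum _ _ _ _ s hs, Preadditive.sum_comp]
      simp
    rw [Finset.sum_congr rfl h1, Finset.sum_congr rfl h2, Finset.sum_comm]
  one_mul a := by
    ext p r
    rw [entry_mul, finsum_eq_single _ r fun q hq => by rw [entry_one_ne hq]; simp,
      entry_one_self, Category.comp_id]
  mul_one a := by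
    ext p r
    rw [entry_mul, finsum_eq_single _ p fun q hq => by rw [entry_one_ne hq.symm]; simp,
      entry_one_self, Category.id_comp]

noncomputable instance : Algebra k (OrbitAlgebra F) :=
  Algebra.ofModule
    (fun c a b => by
      ext p r
      have hb : ∀ q, b.entry p q ≠ 0 → q ∈ (b.finite_left p).toFinset := by simp
      rw [entry_smul, entry_mul_eq_sum _ _ _ _ _ hb, entry_mul_eq_sum _ _ _ _ _ hb,
        Finset.smul_sum]
      simp)
    (fun c a b => by
      ext p r
      have hb : ∀ q, b.entry p q ≠ 0 → q ∈ (b.finite_left p).toFinset := by simp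
      rw [entry_smul, entry_mul_eq_sum _ _ _ _ _ hb, entry_mul_eq_sum _ _ _ _
        (b.finite_left p).toFinset (fun q h => hb q fun h0 => h (by simp [h0])), Finset.smul_sum]
      simp)

end OrbitAlgebra

end Orbit

/-! ### The repetition of a linear category -/

section Repetition

/-- The objects `x^[i]`, `i ∈ ℤ`, of the repetition of `C`. -/
@[ext] structure Repetition (k : Type u) (C : Type w) where
  base : C
  level : ℤ

variable {k : Type u} [Field k] {C : Type w} [Category.{v} C] [Preadditive C] [Linear k C]

namespace Repetition

/-- The morphisms `x^[i] ⟶ y^[j]`: this is `C(x, y)` if `j = i`, the dual space `D C(y, x)` if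
`j = i + 1`, and zero otherwise; it is written as the space of all pairs in
`C(x, y) × D C(y, x)` whose first (second) entry is zero unless `j = i` (`j = i + 1`). -/
def homSubmodule (X Y : Repetition k C) :
    Submodule k ((X.base ⟶ Y.base) × Module.Dual k (Y.base ⟶ X.base)) where
  carrier := {f | (Y.level ≠ X.level → f.1 = 0) ∧ (Y.level ≠ X.level + 1 → f.2 = 0)}
  add_mem' := by
    rintro f g ⟨hf1, hf2⟩ ⟨hg1, hg2⟩
    exact ⟨fun h => by simp [hf1 h, hg1 h], fun h => by simp [hf2 h, hg2 h]⟩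
  zero_mem' := by simp
  smul_mem' := by
    rintro c f ⟨hf1, hf2⟩
    exact ⟨fun h => by simp [hf1 h], fun h => by simp [hf2 h]⟩

/-- The bimodule structure of the dual: `(φ ≫ g)(h) = φ (g ≫ h)` for `φ ∈ D C(y, x)`,
`g : y ⟶ z`. -/
def dualComp {x y z : C} (φ : Module.Dual k (y ⟶ x)) (g : y ⟶ z) : Module.Dual k (z ⟶ x) :=
  φ ∘ₗ Linear.leftComp k x g

/-- The bimodule structure of the dual: `(f ≫ ψ)(h) = ψ (h ≫ f)` for `f : x ⟶ y`,
`ψ ∈ D C(z, y)`. -/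
def compDual {x y z : C} (f : x ⟶ y) (ψ : Module.Dual k (z ⟶ y)) : Module.Dual k (z ⟶ x) :=
  ψ ∘ₗ Linear.rightComp k z f

@[simp] theorem dualComp_apply {x y z : C} (φ : Module.Dual k (y ⟶ x)) (g : y ⟶ z) (h : z ⟶ x) :
    dualComp φ g h = φ (g ≫ h) := rfl
@[simp] theorem compDual_apply {x y z : C} (f : x ⟶ y) (ψ : Module.Dual k (z ⟶ y)) (h : z ⟶ x) :
    compDual f ψ h = ψ (h ≫ f) := rfl

/-- Composition in the repetition is given by composition in `C` and the bimodule structure of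
`D C`; two morphisms in `D C` compose to zero. -/
instance : Category (Repetition k C) where
  Hom X Y := homSubmodule X Y
  id X := ⟨(𝟙 X.base, 0), by simp [homSubmodule]⟩
  comp {X Y Z} f g := ⟨(f.1.1 ≫ g.1.1, dualComp f.1.2 g.1.1 + compDual f.1.1 g.1.2), by
    obtain ⟨⟨f, φ⟩, hf, hφ⟩ := f
    obtain ⟨⟨g, ψ⟩, hg, hψ⟩ := g
    dsimp only at hf hφ hg hψ ⊢
    constructor
    · intro h
      by_cases h1 : Y.level = X.level
      · rw [hg (by omega)]; simp
      · rw [hf h1]; simp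
    · intro h
      have e1 : dualComp φ g = 0 := by
        by_cases h1 : Y.level = X.level + 1
        · rw [hg (by omega)]; ext; simp
        · rw [hφ h1]; ext; simp
      have e2 : compDual f ψ = 0 := by
        by_cases h1 : Y.level = X.level
        · rw [hψ (by omega)]; ext; simp
        · rw [hf h1]; ext; simp
      simp [e1, e2]⟩
  id_comp f := by
    refine Subtype.ext (Prod.ext (by simp) ?_)
    ext h
    simp
  comp_id f := by
    refine Subtype.ext (Prod.ext (by simp) ?_)
    ext h
    simp
  assoc f g h := by
    refine Subtype.ext (Prod.ext (by simp) ?_)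
    ext x
    simp [add_assoc]

/-- The component in `C(x, y)` of a morphism `x^[i] ⟶ y^[j]`. -/
def homFst {X Y : Repetition k C} (f : X ⟶ Y) : X.base ⟶ Y.base := f.1.1

/-- The component in `D C(y, x)` of a morphism `x^[i] ⟶ y^[j]`. -/
def homSnd {X Y : Repetition k C} (f : X ⟶ Y) : Module.Dual k (Y.base ⟶ X.base) := f.1.2

theorem homFst_eq_zero {X Y : Repetition k C} (f : X ⟶ Y) (h : Y.level ≠ X.level) :
    homFst f = 0 := f.2.1 h

theorem homSnd_eq_zero {X Y : Repetition k C} (f : X ⟶ Y) (h : Y.level ≠ X.level + 1) :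
    homSnd f = 0 := f.2.2 h

/-- A morphism of the repetition from its two components. -/
def homMk {X Y : Repetition k C} (f : X.base ⟶ Y.base) (φ : Module.Dual k (Y.base ⟶ X.base))
    (hf : Y.level ≠ X.level → f = 0) (hφ : Y.level ≠ X.level + 1 → φ = 0) : X ⟶ Y :=
  ⟨(f, φ), hf, hφ⟩

@[ext] theorem hom_ext {X Y : Repetition k C} {f g : X ⟶ Y} (h1 : homFst f = homFst g)
    (h2 : homSnd f = homSnd g) : f = g := Subtype.ext (Prod.ext h1 h2)

@[simp] theorem homFst_homMk {X Y : Repetition k C} (f : X.base ⟶ Y.base)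
    (φ : Module.Dual k (Y.base ⟶ X.base)) (hf hφ) :
    homFst (homMk (X := X) (Y := Y) f φ hf hφ) = f := rfl
@[simp] theorem homSnd_homMk {X Y : Repetition k C} (f : X.base ⟶ Y.base)
    (φ : Module.Dual k (Y.base ⟶ X.base)) (hf hφ) :
    homSnd (homMk (X := X) (Y := Y) f φ hf hφ) = φ := rfl
@[simp] theorem homFst_id (X : Repetition k C) : homFst (𝟙 X) = 𝟙 X.base := rfl
@[simp] theorem homSnd_id (X : Repetition k C) : homSnd (𝟙 X) = 0 := rfl
@[simp] theorem homFst_comp {X Y Z : Repetition k C} (f : X ⟶ Y) (g : Y ⟶ Z) :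
    homFst (f ≫ g) = homFst f ≫ homFst g := rfl
@[simp] theorem homSnd_comp {X Y Z : Repetition k C} (f : X ⟶ Y) (g : Y ⟶ Z) :
    homSnd (f ≫ g) = dualComp (homSnd f) (homFst g) + compDual (homFst f) (homSnd g) := rfl

instance (X Y : Repetition k C) : AddCommGroup (X ⟶ Y) :=
  inferInstanceAs (AddCommGroup (homSubmodule X Y))
instance (X Y : Repetition k C) : Module k (X ⟶ Y) :=
  inferInstanceAs (Module k (homSubmodule X Y))

@[simp] theorem homFst_add {X Y : Repetition k C} (f g : X ⟶ Y) :
    homFst (f + g) = homFst f + homFst g := rfl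
@[simp] theorem homSnd_add {X Y : Repetition k C} (f g : X ⟶ Y) :
    homSnd (f + g) = homSnd f + homSnd g := rfl
@[simp] theorem homFst_smul {X Y : Repetition k C} (c : k) (f : X ⟶ Y) :
    homFst (c • f) = c • homFst f := rfl
@[simp] theorem homSnd_smul {X Y : Repetition k C} (c : k) (f : X ⟶ Y) :
    homSnd (c • f) = c • homSnd f := rfl

instance : Preadditive (Repetition k C) where
  homGroup X Y := inferInstance
  add_comp X Y Z f f' g := by
    ext
    · simp
    · simp
      abel
  comp_add X Y Z f g g' := by
    ext
    · simp
    · simp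
      abel

instance : Linear k (Repetition k C) where
  homModule X Y := inferInstance
  smul_comp X Y Z c f g := by
    ext <;> simp
  comp_smul X Y Z f c g := by
    ext <;> simp

/-- The automorphism `ν ^ d`, where `ν` is the Nakayama automorphism of the repetition:
`ν x^[i] = x^[i + 1]`, and `ν` is the identity on the components of the morphisms.
This `ν` is the Nakayama automorphism for right modules, `D Ĉ(X, -) ≅ Ĉ(-, ν X)`; the one for left
modules, `D Ĉ(-, X) ≅ Ĉ(ν' X, -)`, is its inverse, which is the case `d = -1`. -/
def nakayama (k : Type u) [Field k] (C : Type w) [Category.{v} C] [Preadditive C] [Linear k C]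
    (d : ℤ) : LinearAut k (Repetition k C) where
  functor :=
    { obj := fun X => ⟨X.base, X.level + d⟩
      map := fun {X Y} f => homMk (X := ⟨X.base, X.level + d⟩) (Y := ⟨Y.base, Y.level + d⟩)
        (homFst (X := X) (Y := Y) f) (homSnd (X := X) (Y := Y) f)
        (fun h => homFst_eq_zero f fun e => h (by simp [e]))
        (fun h => homSnd_eq_zero f fun e => h (by simp only [e]; ring))
      map_id := fun X => rfl
      map_comp := fun f g => rfl }
  map_add f g := rfl
  map_smul c f := rfl
  obj_bijective := by
    refine ⟨fun X Y h => ?_, fun Y => ⟨⟨Y.base, Y.level - d⟩, by simp⟩⟩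
    simp only [Repetition.mk.injEq] at h
    exact Repetition.ext h.1 (by omega)
  map_bijective X Y := by
    let X' : Repetition k C := ⟨X.base, X.level + d⟩
    let Y' : Repetition k C := ⟨Y.base, Y.level + d⟩
    refine ⟨fun f g h => hom_ext (congrArg (homFst (X := X') (Y := Y')) h)
      (congrArg (homSnd (X := X') (Y := Y')) h), fun (f : X' ⟶ Y') => ?_⟩
    exact ⟨homMk (X := X) (Y := Y) (homFst (X := X') (Y := Y') f) (homSnd (X := X') (Y := Y') f)
      (fun h => homFst_eq_zero (X := X') (Y := Y') f fun e => h (by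
        change Y.level + d = X.level + d at e
        omega))
      (fun h => homSnd_eq_zero (X := X') (Y := Y') f fun e => h (by
        change Y.level + d = X.level + d + 1 at e
        omega)), rfl⟩

/-- The canonical extension of an automorphism `φ` of `C` to the repetition: `x^[i] ↦ (φ x)^[i]`;
it is `φ` on `C(x, y)`, and `u ↦ u ∘ φ⁻¹` from `D C(y, x)` to `D C(φ y, φ x)`. -/
noncomputable def hat (φ : LinearAut k C) : LinearAut k (Repetition k C) where
  functor :=
    { obj := fun X => ⟨φ.functor.obj X.base, X.level⟩
      map := fun {X Y} f => homMk (X := ⟨φ.functor.obj X.base, X.level⟩)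
        (Y := ⟨φ.functor.obj Y.base, Y.level⟩)
        (φ.functor.map (homFst f))
        (homSnd f ∘ₗ (φ.homEquiv Y.base X.base).symm.toLinearMap)
        (fun h => by rw [homFst_eq_zero f h, φ.map_zero])
        (fun h => by rw [homSnd_eq_zero f h, LinearMap.zero_comp])
      map_id := fun X => by ext <;> simp
      map_comp := fun {X Y Z} f g => by
        ext h
        · simp
        · obtain ⟨h, rfl⟩ := (φ.homEquiv Z.base X.base).surjective h
          have e1 : φ.functor.map (homFst g) ≫ φ.homEquiv Z.base X.base h =
              φ.homEquiv _ _ (homFst g ≫ h) := by simp [φ.homEquiv_apply]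
          have e2 : φ.homEquiv Z.base X.base h ≫ φ.functor.map (homFst f) =
              φ.homEquiv _ _ (h ≫ homFst f) := by simp [φ.homEquiv_apply]
          simp [e1, e2] }
  map_add f g := by ext <;> simp [φ.map_add]
  map_smul c f := by ext <;> simp [φ.map_smul]
  obj_bijective := by
    refine ⟨fun X Y h => ?_, fun Y => ?_⟩
    · simp only [Repetition.mk.injEq] at h
      exact Repetition.ext (φ.obj_bijective.1 h.1) h.2
    · obtain ⟨x, hx⟩ := φ.obj_bijective.2 Y.base
      exact ⟨⟨x, Y.level⟩, Repetition.ext hx rfl⟩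
  map_bijective X Y := by
    refine ⟨fun f g h => hom_ext ?_ ?_, fun f => ?_⟩
    · exact (φ.map_bijective _ _).1 (congrArg homFst h)
    · have h2 : homSnd f ∘ₗ (φ.homEquiv Y.base X.base).symm.toLinearMap =
        homSnd g ∘ₗ (φ.homEquiv Y.base X.base).symm.toLinearMap := congrArg homSnd h
      ext x
      simpa using LinearMap.congr_fun h2 (φ.homEquiv _ _ x)
    · refine ⟨homMk (X := X) (Y := Y) ((φ.homEquiv _ _).symm (homFst f))
        (homSnd f ∘ₗ (φ.homEquiv Y.base X.base).toLinearMap)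
        (fun h => by rw [homFst_eq_zero f h, _root_.map_zero])
        (fun h => by rw [homSnd_eq_zero f h, LinearMap.zero_comp]), ?_⟩
      refine hom_ext ?_ ?_
      · exact (φ.homEquiv _ _).apply_symm_apply (homFst f)
      · refine LinearMap.ext fun x => ?_
        exact congrArg (homSnd f) ((φ.homEquiv _ _).apply_symm_apply x)

end Repetition

/-- The automorphism `ν ^ d ∘ φ̂` of the repetition of `C`. -/
noncomputable def twist (φ : LinearAut k C) (d : ℤ) : LinearAut k (Repetition k C) :=
  (Repetition.hat φ).comp (Repetition.nakayama k C d)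

/-- The twisted `d`-fold extension of `C` by `φ`: the algebra of the orbit category of the
repetition of `C` by the group generated by `ν ^ d ∘ φ̂`. -/
abbrev TwistedExtension (φ : LinearAut k C) (d : ℤ) : Type (max w u v) :=
  OrbitAlgebra (twist φ d)

/-- The idempotent of the twisted extension at (the orbit of) the object `x = x^[0]` of `C`. -/
noncomputable def vertexIdempotent (φ : LinearAut k C) (d : ℤ) (x : C) : TwistedExtension φ d :=
  OrbitAlgebra.idempotent (twist φ d) ⟨x, 0⟩

end Repetition

/-! ### Path categories and their automorphisms induced by quiver automorphisms -/

section PathAlgebra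

/-- An automorphism of a quiver. -/
structure QuiverAut (V : Type w) [Quiver.{v} V] where
  toPrefunctor : V ⥤q V
  obj_bijective : Function.Bijective toPrefunctor.obj
  map_bijective : ∀ a b : V, Function.Bijective (toPrefunctor.map : (a ⟶ b) → _)

/-- The path algebra `kQ`, as a `k`-linear category: the objects are the vertices, and the
morphisms from `a` to `b` are the formal `k`-linear combinations of paths from `a` to `b`. -/
abbrev PathCategory (k : Type u) [Field k] (V : Type w) [Quiver.{v} V] := Free k (Paths V)

variable {V : Type w} [Quiver.{v} V]

theorem QuiverAut.mapPath_injective (s : QuiverAut V) {a b : V} (p q : Quiver.Path a b)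
    (h : s.toPrefunctor.mapPath p = s.toPrefunctor.mapPath q) : p = q := by
  induction p with
  | nil =>
    cases q with
    | nil => rfl
    | cons q f => simpa using congrArg Quiver.Path.length h
  | @cons b' c p e ih =>
    generalize hq : q = q'
    cases q' with
    | nil => subst hq; simpa using congrArg Quiver.Path.length h
    | @cons b'' _ q' f =>
      subst hq
      simp only [Prefunctor.mapPath_cons, Quiver.Path.cons.injEq] at h
      obtain ⟨h1, h2, h3⟩ := h
      have hb := s.obj_bijective.1 h1
      subst hb
      rw [ih q' (eq_of_heq h2), (s.map_bijective _ _).1 (eq_of_heq h3)]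

theorem QuiverAut.mapPath_surjective (s : QuiverAut V) {a : V} {c : V}
    (p : Quiver.Path (s.toPrefunctor.obj a) c) (b : V) (hb : s.toPrefunctor.obj b = c) :
    ∃ q : Quiver.Path a b, s.toPrefunctor.mapPath q = hb ▸ p := by
  induction p generalizing b with
  | nil =>
    have := s.obj_bijective.1 hb
    subst this
    exact ⟨Quiver.Path.nil, rfl⟩
  | @cons d c p e ih =>
    subst hb
    obtain ⟨d, rfl⟩ := s.obj_bijective.2 d
    obtain ⟨q, hq⟩ := ih d rfl
    obtain ⟨f, rfl⟩ := (s.map_bijective _ _).2 e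
    exact ⟨q.cons f, by simp [hq]⟩

/-- The action of a quiver automorphism on the objects of the path algebra. -/
def QuiverAut.mapObj (k : Type u) [Field k] (s : QuiverAut V) (X : PathCategory k V) :
    PathCategory k V := s.toPrefunctor.obj X

/-- The linear extension of a quiver automorphism to the linear combinations of paths. -/
noncomputable def QuiverAut.mapHom (k : Type u) [Field k] (s : QuiverAut V)
    (X Y : PathCategory k V) (f : X ⟶ Y) :
    s.mapObj k X ⟶ s.mapObj k Y :=
  Finsupp.mapDomain (M := k) (fun p : Quiver.Path (V := V) X Y => s.toPrefunctor.mapPath p) f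

theorem QuiverAut.mapHom_single (k : Type u) [Field k] (s : QuiverAut V)
    (X Y : PathCategory k V) (p : Quiver.Path (V := V) X Y) (c : k) :
    s.mapHom k X Y (Finsupp.single p c) = Finsupp.single (s.toPrefunctor.mapPath p) c :=
  Finsupp.mapDomain_single

theorem QuiverAut.mapHom_add (k : Type u) [Field k] (s : QuiverAut V)
    (X Y : PathCategory k V) (f g : X ⟶ Y) :
    s.mapHom k X Y (f + g) = s.mapHom k X Y f + s.mapHom k X Y g :=
  Finsupp.mapDomain_add

theorem QuiverAut.mapHom_zero (k : Type u) [Field k] (s : QuiverAut V)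
    (X Y : PathCategory k V) : s.mapHom k X Y 0 = 0 :=
  Finsupp.mapDomain_zero

theorem QuiverAut.mapHom_comp (k : Type u) [Field k] (s : QuiverAut V)
    (X Y Z : PathCategory k V) (f : X ⟶ Y) (g : Y ⟶ Z) :
    s.mapHom k X Z (f ≫ g) = s.mapHom k X Y f ≫ s.mapHom k Y Z g := by
  refine Finsupp.induction_linear (M := k) f ?_ ?_ ?_
  · refine (congrArg (s.mapHom k X Z) Limits.zero_comp).trans ?_
    refine (s.mapHom_zero k X Z).trans ?_
    refine ((Limits.zero_comp (X := s.mapObj k X) (Y := s.mapObj k Y)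
      (f := s.mapHom k Y Z g)).symm.trans ?_)
    exact congrArg (· ≫ s.mapHom k Y Z g) (s.mapHom_zero k X Y).symm
  · intro f₁ f₂ h₁ h₂
    refine (congrArg (s.mapHom k X Z) (Preadditive.add_comp X Y Z f₁ f₂ g)).trans ?_
    refine (s.mapHom_add k X Z _ _).trans ?_
    rw [h₁, h₂, ← Preadditive.add_comp]
    exact congrArg (· ≫ s.mapHom k Y Z g) (s.mapHom_add k X Y f₁ f₂).symm
  · intro p c
    refine Finsupp.induction_linear (M := k) g ?_ ?_ ?_
    · refine (congrArg (s.mapHom k X Z) Limits.comp_zero).trans ?_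
      refine (s.mapHom_zero k X Z).trans ?_
      refine ((Limits.comp_zero (Y := s.mapObj k Y) (Z := s.mapObj k Z)
        (f := s.mapHom k X Y (Finsupp.single p c))).symm.trans ?_)
      exact congrArg (s.mapHom k X Y _ ≫ ·) (s.mapHom_zero k Y Z).symm
    · intro g₁ g₂ h₁ h₂
      refine (congrArg (s.mapHom k X Z) (Preadditive.comp_add X Y Z _ g₁ g₂)).trans ?_
      refine (s.mapHom_add k X Z _ _).trans ?_
      rw [h₁, h₂, ← Preadditive.comp_add]
      exact congrArg (s.mapHom k X Y _ ≫ ·) (s.mapHom_add k Y Z g₁ g₂).symm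
    · intro q d
      refine (congrArg (s.mapHom k X Z) (Free.single_comp_single k (C := Paths V) p q c d)).trans ?_
      refine (s.mapHom_single k X Z _ _).trans ?_
      have e : s.toPrefunctor.mapPath (Quiver.Path.comp (V := V) p q) =
          (s.toPrefunctor.mapPath p).comp (s.toPrefunctor.mapPath q) :=
        s.toPrefunctor.mapPath_comp p q
      refine (congrArg (fun z => Finsupp.single z (c * d)) e).trans ?_
      refine (Free.single_comp_single k (C := Paths V) (s.toPrefunctor.mapPath p)
        (s.toPrefunctor.mapPath q) c d).symm.trans ?_
      exact congrArg₂ (fun a b => a ≫ b) (s.mapHom_single k X Y p c).symm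
        (s.mapHom_single k Y Z q d).symm

/-- The linearization of a quiver automorphism, an automorphism of the path algebra. -/
noncomputable def QuiverAut.linearize (k : Type u) [Field k] (s : QuiverAut V) :
    LinearAut k (PathCategory k V) where
  functor :=
    { obj := s.mapObj k
      map := fun {X Y} f => s.mapHom k X Y f
      map_id := fun X => s.mapHom_single k X X Quiver.Path.nil 1
      map_comp := fun {X Y Z} f g => s.mapHom_comp k X Y Z f g }
  map_add {X Y} f g := s.mapHom_add k X Y f g
  map_smul c f := Finsupp.mapDomain_smul c f
  obj_bijective := s.obj_bijective
  map_bijective X Y := by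
    have hb : Function.Bijective (fun p : Quiver.Path (V := V) X Y => s.toPrefunctor.mapPath p) :=
      ⟨s.mapPath_injective, fun p => s.mapPath_surjective p Y rfl⟩
    exact ⟨Finsupp.mapDomain_injective hb.1, Finsupp.mapDomain_surjective hb.2⟩

end PathAlgebra

/-! ### The quiver of a permutation with an enumeration of its cycles -/

/-- A decomposition `σ = (x₁₁ x₁₂ ⋯ x₁ₜ₍₁₎) ⋯ (xₘ₁ xₘ₂ ⋯ xₘₜ₍ₘ₎)` into disjoint cycles of
lengths `t i ≥ 1` whose union is the whole set: `x ⟨i, j⟩` is the `j`-th entry of the `i`-th cycle,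
and `finRotate` is `j ↦ j + 1` modulo `t i`. All indices start from `0`. -/
structure CycleDecomposition {n : ℕ} (σ : Equiv.Perm (Fin n)) where
  m : ℕ
  t : Fin m → ℕ
  t_pos : ∀ i, 0 < t i
  x : (Σ i : Fin m, Fin (t i)) ≃ Fin n
  map_x : ∀ (i : Fin m) (j : Fin (t i)), σ (x ⟨i, j⟩) = x ⟨i, finRotate (t i) j⟩

/-- Every permutation has such a decomposition. -/
theorem CycleDecomposition.nonempty {n : ℕ} (σ : Equiv.Perm (Fin n)) :
    Nonempty (CycleDecomposition σ) := by
  classical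
  let e := (Fintype.equivFin (Quotient (Equiv.Perm.SameCycle.setoid σ))).symm
  let r : Fin _ → Fin n := fun i => (e i).out
  have hpos : ∀ a : Fin n, 0 < Function.minimalPeriod σ a := fun a =>
    Function.minimalPeriod_pos_of_mem_periodicPts
      (Function.Injective.mem_periodicPts σ.injective a)
  have hr : ∀ i, Quotient.mk (Equiv.Perm.SameCycle.setoid σ) (r i) = e i := fun i =>
    Quotient.out_eq _
  let f : (Σ i, Fin (Function.minimalPeriod σ (r i))) → Fin n := fun p => σ^[(p.2 : ℕ)] (r p.1)
  have hq : ∀ p, Quotient.mk (Equiv.Perm.SameCycle.setoid σ) (f p) = e p.1 := fun p => by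
    rw [← hr]
    refine Quotient.sound (show σ.SameCycle _ _ from Equiv.Perm.SameCycle.symm ⟨(p.2 : ℕ), ?_⟩)
    simp only [f, zpow_natCast, ← Equiv.Perm.iterate_eq_pow]
  have hf : Function.Bijective f := by
    constructor
    · intro p q h
      obtain ⟨i, j⟩ := p
      obtain ⟨i', j'⟩ := q
      have hi : i = i' := e.injective (by rw [← hq ⟨i, j⟩, h, hq])
      subst hi
      have := Function.iterate_injOn_Iio_minimalPeriod (f := σ) (x := r i) j.2 j'.2 h
      rw [Fin.ext this]
    · intro y
      obtain ⟨i, hi⟩ := e.surjective (Quotient.mk _ y)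
      have h1 : σ.SameCycle (r i) y := Quotient.exact ((hr i).trans hi)
      obtain ⟨m, hm⟩ := h1.exists_nat_pow_eq
      refine ⟨⟨i, ⟨m % _, Nat.mod_lt _ (hpos _)⟩⟩, ?_⟩
      simp only [f, Function.iterate_mod_minimalPeriod_eq]
      rw [Equiv.Perm.iterate_eq_pow, hm]
  refine ⟨⟨_, fun i => Function.minimalPeriod σ (r i), fun i => hpos _, Equiv.ofBijective f hf,
    fun i j => ?_⟩⟩
  change σ (σ^[(j : ℕ)] (r i)) = σ^[(finRotate _ j : ℕ)] (r i)
  rw [← Function.iterate_succ_apply' σ]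
  have key : ∀ (T : ℕ) (hT : σ^[T] (r i) = r i) (j : Fin T),
      σ^[(j : ℕ).succ] (r i) = σ^[(finRotate T j : ℕ)] (r i) := by
    intro T hT j
    cases T with
    | zero => exact j.elim0
    | succ T =>
      rw [coe_finRotate]
      split_ifs with h
      · subst h
        simpa using hT
      · rfl
  exact key _ (Function.iterate_minimalPeriod) j

section CycleQuiver

variable {n : ℕ} {σ : Equiv.Perm (Fin n)}

/-- The vertices of the quiver: the pairs `⟨i, j⟩`, standing for `x ⟨i, j⟩ ∈ {1, …, n}`. -/
def CycleDecomposition.Vertex (D : CycleDecomposition σ) : Type := Σ i : Fin D.m, Fin (D.t i)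

/-- The vertex corresponding to an element of `{1, …, n}`. -/
def CycleDecomposition.vertex (D : CycleDecomposition σ) (a : Fin n) : D.Vertex := D.x.symm a

/-- The arrows between the vertices of the consecutive cycles `i` and `i' = i + 1`: one arrow
`α i j l : ⟨i, j⟩ ⟶ ⟨i + 1, l⟩` for all `j`, `l` if the cycle `i` is the first, third, fifth, …
one, and one arrow `β i j l : ⟨i + 1, l⟩ ⟶ ⟨i, j⟩` for all `j`, `l` if it is the second, fourth, …
one (the indices `i` start from `0`, which exchanges `Even` and `Odd`). -/
inductive CycleDecomposition.Arrow (D : CycleDecomposition σ) : D.Vertex → D.Vertex → Type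
  | alpha {i i' : Fin D.m} (hi' : (i : ℕ) + 1 = i') (hi : Even (i : ℕ)) (j : Fin (D.t i))
      (l : Fin (D.t i')) : D.Arrow ⟨i, j⟩ ⟨i', l⟩
  | beta {i i' : Fin D.m} (hi' : (i : ℕ) + 1 = i') (hi : Odd (i : ℕ)) (j : Fin (D.t i))
      (l : Fin (D.t i')) : D.Arrow ⟨i', l⟩ ⟨i, j⟩

instance (D : CycleDecomposition σ) : Quiver.{0} D.Vertex := ⟨D.Arrow⟩

theorem CycleDecomposition.arrow_iff (D : CycleDecomposition σ) (a b : D.Vertex) :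
    Nonempty (a ⟶ b) ↔ ((a.1 : ℕ) + 1 = b.1 ∧ Even (a.1 : ℕ)) ∨
      ((b.1 : ℕ) + 1 = a.1 ∧ Odd (b.1 : ℕ)) := by
  constructor
  · rintro ⟨(f : D.Arrow a b)⟩
    cases f with
    | alpha hi' hi j l => exact .inl ⟨hi', hi⟩
    | beta hi' hi j l => exact .inr ⟨hi', hi⟩
  · obtain ⟨i, j⟩ := a
    obtain ⟨i', l⟩ := b
    rintro (⟨h1, h2⟩ | ⟨h1, h2⟩)
    · exact ⟨.alpha h1 h2 j l⟩
    · exact ⟨.beta h1 h2 l j⟩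

/-- There is at most one arrow between two vertices, so a permutation of the vertices extends
in at most one way to an automorphism of the quiver. -/
instance (D : CycleDecomposition σ) (a b : D.Vertex) : Subsingleton (a ⟶ b) := by
  refine ⟨fun (f g : D.Arrow a b) => ?_⟩
  cases f with
  | alpha hi' hi j l =>
    cases g with
    | alpha => rfl
    | beta => omega
  | beta hi' hi j l =>
    cases g with
    | alpha => omega
    | beta => rfl

/-- The automorphism of the quiver which is `σ` on the vertices. -/
def CycleDecomposition.quiverAut (D : CycleDecomposition σ) : QuiverAut D.Vertex where
  toPrefunctor :=
    { obj := fun a => ⟨a.1, finRotate (D.t a.1) a.2⟩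
      map := fun {a b} (f : D.Arrow a b) => match f with
        | .alpha hi' hi j l => .alpha hi' hi (finRotate _ j) (finRotate _ l)
        | .beta hi' hi j l => .beta hi' hi (finRotate _ j) (finRotate _ l) }
  obj_bijective := (Equiv.sigmaCongrRight fun i => finRotate (D.t i)).bijective
  map_bijective a b := by
    refine ⟨fun f g _ => Subsingleton.elim f g, fun g => ?_⟩
    suffices h : Nonempty (a ⟶ b) from ⟨h.some, Subsingleton.elim _ _⟩
    exact (D.arrow_iff a b).2 ((D.arrow_iff ⟨a.1, finRotate _ a.2⟩
      ⟨b.1, finRotate _ b.2⟩).1 ⟨g⟩)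

/-- The action of `quiverAut` on the vertices is `σ` under the identification of the vertices
with `{1, …, n}`. -/
theorem CycleDecomposition.x_quiverAut (D : CycleDecomposition σ) (a : D.Vertex) :
    D.x (D.quiverAut.toPrefunctor.obj a) = σ (D.x a) := (D.map_x a.1 a.2).symm

/-- `σ` as an automorphism of the path algebra of the quiver. -/
noncomputable def CycleDecomposition.pathAut (D : CycleDecomposition σ) (k : Type u) [Field k] :
    LinearAut k (PathCategory k D.Vertex) := D.quiverAut.linearize k

/-- The twisted `d`-fold extension of the path algebra of the quiver by `σ`: the twisted `1`-fold
extension for `d = 1`, and its analogue with `ν⁻¹` in place of `ν` for `d = -1`. -/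
abbrev CycleDecomposition.Extension (D : CycleDecomposition σ) (k : Type u) [Field k] (d : ℤ) :
    Type u := TwistedExtension (D.pathAut k) d

/-- The idempotents of the twisted extension, indexed by `{1, …, n}`. -/
noncomputable def CycleDecomposition.idempotent (D : CycleDecomposition σ) (k : Type u) [Field k]
    (d : ℤ) (a : Fin n) : D.Extension k d :=
  vertexIdempotent (D.pathAut k) d (D.vertex a : PathCategory k D.Vertex)

end CycleQuiver

/-! ### Self-injective algebras and Nakayama permutations -/

section Nakayama

/-- The socle of a module: the sum of its simple submodules. -/
def socle (R M : Type*) [Ring R] [AddCommGroup M] [Module R M] : Submodule R M :=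
  sSup {S : Submodule R M | IsSimpleModule R S}

/-- The top of a module: its quotient by its radical. -/
abbrev Top (R M : Type*) [Ring R] [AddCommGroup M] [Module R M] : Type _ :=
  M ⧸ Module.jacobson R M

/-- A self-injective algebra over a field: a finite-dimensional algebra that is injective as a
left and as a right module over itself. -/
structure IsSelfInjectiveAlgebra (k : Type*) (A : Type*) [Field k] [Ring A] [Algebra k A] :
    Prop where
  finite : Module.Finite k A
  left : Module.Injective A A
  right : Module.Injective Aᵐᵒᵖ A

variable {A : Type*} [Ring A]

/-- The left ideal `A e`. -/
abbrev leftProj (e : A) : Submodule A A := Submodule.span A {e}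

/-- The right ideal `e A`, as a right `A`-module. -/
abbrev rightProj (e : A) : Submodule Aᵐᵒᵖ A := Submodule.span Aᵐᵒᵖ {e}

/-- A complete system of orthogonal primitive idempotents whose projective modules are pairwise
nonisomorphic; a ring with such a system is basic. -/
structure IsBasicSystem {ι : Type*} [Fintype ι] (e : ι → A) : Prop where
  complete : CompleteOrthogonalIdempotents e
  ne_zero : ∀ i, e i ≠ 0
  primitive : ∀ i (f g : A), IsIdempotentElem f → IsIdempotentElem g → f * g = 0 → g * f = 0 →
    e i = f + g → f = 0 ∨ g = 0
  not_iso : ∀ i j, Nonempty (rightProj (e i) ≃ₗ[Aᵐᵒᵖ] rightProj (e j)) → i = j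

/-- `π` is the Nakayama permutation, for right modules: `soc (e_i A) ≅ top (e_{π i} A)`. -/
def IsNakayamaPermutation {ι : Type*} (e : ι → A) (π : Equiv.Perm ι) : Prop :=
  ∀ i, Nonempty (socle Aᵐᵒᵖ (rightProj (e i)) ≃ₗ[Aᵐᵒᵖ] Top Aᵐᵒᵖ (rightProj (e (π i))))

/-- `π` is the Nakayama permutation, for left modules: `soc (A e_i) ≅ top (A e_{π i})`. -/
def IsLeftNakayamaPermutation {ι : Type*} (e : ι → A) (π : Equiv.Perm ι) : Prop :=
  ∀ i, Nonempty (socle A (leftProj (e i)) ≃ₗ[A] Top A (leftProj (e (π i))))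

end Nakayama

end TwistedExt

/-! Everything is read off one Frobenius form on the algebra: add up, over the vertices x, the
values at the identity of x of the functionals in D C(x, x) that are the entries from x^[0] to
x^[1]. It is nondegenerate because every nonzero morphism x^[0] → Y of the repetition can be
continued to a nonzero morphism x^[0] → x^[1] (`frobeniusForm_nondeg`). It need not be symmetric:
lam(e_x a) = lam(a e_{π x}), where (π x)^[1] lies in the orbit of x^[0]. The twist νσ̂ gives π = σ,
and ν⁻¹σ̂ gives π = σ⁻¹.

The ring theory is then formal (`FrobeniusData`). Nondegeneracy identifies A with its dual on both
sides, whence self-injectivity. The socle of e_i A is spanned by the element w with lam(w a) = χ_{π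
i}(a), and A acts on it through the character χ_{π i}, just as on the top of e_{π i} A. For left
modules i and π i change places, so the left Nakayama permutation is π⁻¹; this is why ν⁻¹ is needed
there to obtain σ.

The quiver enters through two properties. There is at most one path between two vertices, so every
morphism space of the repetition is zero or a line with a canonical basis vector, and computations
reduce to scalars that multiply under composition when the end points are related
(`coeff_comp_of_rel`). And there are no paths of length two, so three composable non-identity basis
morphisms compose to zero (`HeightOne.eq_of_rel`), which gives the vanishing of the cube of the
radical. Finally d = ±1 makes each orbit meet each level exactly once, so the orbits are indexed by
the vertices. -/

namespace TwistedExt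

/-! ### Injectivity by duality; tops and socles as quotients by maximal ideals -/

section CyclicModules

variable {R M M' : Type*} [Ring R] [AddCommGroup M] [Module R M] [AddCommGroup M'] [Module R M']

/-- If every functional on `R` is `r ↦ l (r • m)` for a unique `m : M`, then `M` satisfies Baer's
criterion, as `M` is then the dual of the regular right module. -/
theorem baer_of_dual {k : Type*} [Field k] [Algebra k R] [Module k M] [IsScalarTower k R M]
    (l : M →ₗ[k] k) (hinj : ∀ m : M, (∀ r : R, l (r • m) = 0) → m = 0)
    (hsurj : ∀ g : R →ₗ[k] k, ∃ m : M, ∀ r, g r = l (r • m)) : Module.Baer R M := by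
  intro I g
  -- Composition with `l` turns a map on the ideal into a functional, which extends to `R` by linear
  -- algebra; the element representing the extension answers Baer's criterion.
  obtain ⟨g', hg'⟩ := LinearMap.exists_extend
    (p := I.restrictScalars k) (l ∘ₗ (g.restrictScalars k : I.restrictScalars k →ₗ[k] M))
  obtain ⟨m, hm⟩ := hsurj g'
  refine ⟨LinearMap.toSpanSingleton R M m, fun x hx => ?_⟩
  refine sub_eq_zero.1 (hinj _ fun r => ?_)
  have h1 : g' (r * x) = l (g ⟨r * x, I.mul_mem_left r hx⟩) :=
    LinearMap.congr_fun hg' ⟨r * x, I.mul_mem_left r hx⟩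
  have h2 : g ⟨r * x, I.mul_mem_left r hx⟩ = r • g ⟨x, hx⟩ := g.map_smul r ⟨x, hx⟩
  rw [smul_sub, map_sub, ← h2, ← h1, hm, LinearMap.toSpanSingleton_apply, mul_smul, sub_self]

/-- The top of a cyclic module with generator `m`, if the elements `r • m` with `r ∉ I` are
generators. -/
theorem top_equiv_quotient (m : M) (I : Ideal R) (hspan : ∀ x : M, ∃ r : R, r • m = x)
    (hI : I ≠ ⊤) (hm : ∀ r : R, r • m = 0 → r ∈ I)
    (hgen : ∀ r : R, r ∉ I → ∃ s : R, s • r • m = m) :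
    Nonempty (Top R M ≃ₗ[R] R ⧸ I) := by
  let φ := LinearMap.toSpanSingleton R M m
  have mem_N : ∀ r : R, r • m ∈ Submodule.map φ I ↔ r ∈ I := by
    refine fun r => ⟨?_, fun h => ⟨r, h, rfl⟩⟩
    rintro ⟨r', hr', h⟩
    have := hm (r - r') (by rw [sub_smul, sub_eq_zero]; exact h.symm)
    simpa using I.add_mem this hr'
  have top_of : ∀ (N : Submodule R M) (r : R), r • m ∈ N → r ∉ I → N = ⊤ := by
    refine fun N r h1 h2 => eq_top_iff.2 fun x _ => ?_
    obtain ⟨t, rfl⟩ := hspan x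
    obtain ⟨s, hs⟩ := hgen r h2
    rw [← hs]
    exact N.smul_mem _ (N.smul_mem _ h1)
  -- Hence the image of `I` is the largest proper submodule, and so the radical.
  have le_N : ∀ N : Submodule R M, N ≠ ⊤ → N ≤ Submodule.map φ I := by
    intro N hN x hx
    obtain ⟨r, rfl⟩ := hspan x
    exact (mem_N r).2 (by_contra fun h => hN (top_of N r hx h))
  have hNtop : Submodule.map φ I ≠ ⊤ := by
    intro h
    refine hI ((Ideal.eq_top_iff_one I).2 ((mem_N 1).1 (h ▸ Submodule.mem_top)))
  have hcoatom : IsCoatom (Submodule.map φ I) :=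
    ⟨hNtop, fun N hN => by_contra fun h => hN.not_ge (le_N N h)⟩
  have hjac : Module.jacobson R M = Submodule.map φ I :=
    le_antisymm (sInf_le hcoatom) (le_sInf fun N hN =>
      ((hN.le_iff_eq hNtop).1 (le_N N hN.1)).le)
  let ψ := (Module.jacobson R M).mkQ ∘ₗ φ
  have hψ : Function.Surjective ψ := (Submodule.mkQ_surjective _).comp hspan
  have hker : LinearMap.ker ψ = I := by
    ext r
    rw [LinearMap.mem_ker, LinearMap.comp_apply, Submodule.mkQ_apply,
      Submodule.Quotient.mk_eq_zero, hjac]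
    exact mem_N r
  exact ⟨(ψ.quotKerEquivOfSurjective hψ).symm.trans (Submodule.quotEquivOfEq _ _ hker)⟩

/-- The socle of a module, if every simple submodule is contained in `R w`, where the annihilator
of `w` is the maximal left ideal `I`. -/
theorem socle_equiv_quotient (w : M) (I : Ideal R) [hI : I.IsMaximal]
    (hw : ∀ r : R, r • w = 0 ↔ r ∈ I)
    (hess : ∀ s : M, s ≠ 0 → (∀ r : R, r • s ≠ 0 → ∃ r' : R, r' • r • s = s) →
      ∃ r : R, r • w = s) : Nonempty (socle R M ≃ₗ[R] R ⧸ I) := by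
  let φ := LinearMap.toSpanSingleton R M w
  have hker : LinearMap.ker φ = I := by
    ext r
    exact hw r
  let e : LinearMap.range φ ≃ₗ[R] R ⧸ I :=
    φ.quotKerEquivRange.symm.trans (Submodule.quotEquivOfEq _ _ hker)
  have hs : IsSimpleModule R (R ⧸ I) := isSimpleModule_iff_isCoatom.2 hI.out
  -- The range is simple, being `R ⧸ I`. Conversely, a nonzero element of a simple submodule is
  -- recovered from each of its nonzero multiples, so `hess` applies to it.
  have hsoc : socle R M = LinearMap.range φ := by
    refine le_antisymm (sSup_le fun S (hS : IsSimpleModule R S) => ?_)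
      (le_sSup (IsSimpleModule.congr e))
    have key : ∀ s ∈ S, s ≠ 0 → ∀ x ∈ S, ∃ r : R, r • s = x := by
      intro s hs h0 x hx
      have h1 : Submodule.span R {(⟨s, hs⟩ : S)} = ⊤ :=
        (eq_bot_or_eq_top _).resolve_left fun h => h0 (by
          simpa using Submodule.span_singleton_eq_bot.1 h)
      obtain ⟨r, hr⟩ := Submodule.mem_span_singleton.1 (h1 ▸ Submodule.mem_top : (⟨x, hx⟩ : S) ∈ _)
      exact ⟨r, congrArg Subtype.val hr⟩
    intro s hs
    by_cases h0 : s = 0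
    · rw [h0]
      exact Submodule.zero_mem _
    · obtain ⟨r, hr⟩ := hess s h0 fun r hr => key _ (S.smul_mem r hs) hr s hs
      exact ⟨r, hr⟩
  exact ⟨(LinearEquiv.ofEq _ _ hsoc).trans e⟩

end CyclicModules

/-- A Frobenius form `lam` on a split basic algebra with radical cube zero: `e` is the family of
primitive idempotents, `χ` the family of the characters, and `π` the permutation that the Nakayama
automorphism of `lam` induces on the idempotents. -/
structure FrobeniusData (k : Type u) {A : Type u} {ι : Type*} [Field k] [Ring A] [Algebra k A]
    [Fintype ι] (e : ι → A) (χ : ι → A →ₐ[k] k) (lam : A →ₗ[k] k) (π : Equiv.Perm ι) : Prop where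
  finite : Module.Finite k A
  complete : CompleteOrthogonalIdempotents e
  char_self : ∀ i, χ i (e i) = 1
  mul_mul_eq_zero : ∀ a b c, (∀ i, χ i a = 0) → (∀ i, χ i b = 0) → (∀ i, χ i c = 0) →
    a * b * c = 0
  nondeg : ∀ a, (∀ b, lam (b * a) = 0) → a = 0
  twist : ∀ i a, lam (e i * a) = lam (a * e (π i))

/-! ### Ring-theoretic consequences of a Frobenius form -/

namespace FrobeniusData

variable {k : Type u} {A : Type u} {ι : Type*} [Field k] [Ring A] [Algebra k A] [Fintype ι]
  {e : ι → A} {χ : ι → A →ₐ[k] k} {lam : A →ₗ[k] k} {π : Equiv.Perm ι}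

theorem reindex {κ : Type*} [Fintype κ] (h : FrobeniusData k e χ lam π) (f : κ ≃ ι) :
    FrobeniusData k (e ∘ f) (χ ∘ f) lam ((f.trans π).trans f.symm) where
  finite := h.finite
  complete := by
    rw [CompleteOrthogonalIdempotents.equiv]
    exact h.complete
  char_self i := h.char_self _
  mul_mul_eq_zero a b c ha hb hc := h.mul_mul_eq_zero a b c
    (fun i => by simpa using ha (f.symm i)) (fun i => by simpa using hb (f.symm i))
    (fun i => by simpa using hc (f.symm i))
  nondeg := h.nondeg
  twist i a := by simpa using h.twist (f i) a

theorem char_ne (h : FrobeniusData k e χ lam π) {i j : ι} (hij : i ≠ j) : χ i (e j) = 0 := by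
  have := congrArg (χ i) (h.complete.ortho hij)
  simpa [h.char_self] using this

theorem idem (h : FrobeniusData k e χ lam π) (i : ι) : e i * e i = e i := h.complete.idem i

/-- By `nondeg`, `c ↦ lam (· * c)` is injective from `A` to its dual, hence bijective by dimension.
-/
theorem exists_right (h : FrobeniusData k e χ lam π) (g : A →ₗ[k] k) :
    ∃ c, ∀ a, g a = lam (a * c) := by
  have := h.finite
  let B : A →ₗ[k] Module.Dual k A := (LinearMap.mul k A).flip.compr₂ lam
  have hB : Function.Injective B := (injective_iff_map_eq_zero B).2 fun a ha =>
    h.nondeg a fun b => LinearMap.congr_fun ha b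
  obtain ⟨c, hc⟩ := (LinearMap.injective_iff_surjective_of_finrank_eq_finrank
    (Subspace.dual_finrank_eq (K := k) (V := A)).symm).1 hB g
  exact ⟨c, fun a => (LinearMap.congr_fun hc a).symm⟩

/-- Functionals separate points, and each of them has the form `lam (· * c)`. -/
theorem nondeg_left (h : FrobeniusData k e χ lam π) (a : A)
    (ha : ∀ b, lam (a * b) = 0) : a = 0 := by
  refine (Module.forall_dual_apply_eq_zero_iff k a).1 fun g => ?_
  obtain ⟨c, hc⟩ := h.exists_right g
  rw [hc, ha]

theorem exists_left (h : FrobeniusData k e χ lam π) (g : A →ₗ[k] k) :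
    ∃ c, ∀ a, g a = lam (c * a) := by
  have := h.finite
  let B : A →ₗ[k] Module.Dual k A := (LinearMap.mul k A).compr₂ lam
  have hB : Function.Injective B := (injective_iff_map_eq_zero B).2 fun a ha =>
    h.nondeg_left a fun b => LinearMap.congr_fun ha b
  obtain ⟨c, hc⟩ := (LinearMap.injective_iff_surjective_of_finrank_eq_finrank
    (Subspace.dual_finrank_eq (K := k) (V := A)).symm).1 hB g
  exact ⟨c, fun a => (LinearMap.congr_fun hc a).symm⟩

theorem isSelfInjectiveAlgebra (h : FrobeniusData k e χ lam π) :
    IsSelfInjectiveAlgebra k A where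
  finite := h.finite
  left := (baer_of_dual lam h.nondeg h.exists_right).injective
  right := by
    have : IsScalarTower k Aᵐᵒᵖ A := ⟨fun c r a => by simp⟩
    refine (baer_of_dual lam (fun m hm => h.nondeg_left m fun b => hm (MulOpposite.op b))
      fun g => ?_).injective
    obtain ⟨c, hc⟩ := h.exists_left (g ∘ₗ (MulOpposite.opLinearEquiv k).toLinearMap)
    exact ⟨c, fun r => hc r.unop⟩

theorem char_eq_zero_of_mem_jacobson (f : A →ₐ[k] k) {a : A} (ha : a ∈ Ring.jacobson A) :
    f a = 0 := by
  have hs : Function.Surjective f := fun c => ⟨algebraMap k A c, by simp⟩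
  have := RingHom.ker_isMaximal_of_surjective f hs
  exact Ring.jacobson_le_of_isMaximal (RingHom.ker f) ha

/-- Kernels of characters are maximal, so the radical lies in all of them, and products of three
elements of their intersection vanish. -/
theorem jacobson_pow (h : FrobeniusData k e χ lam π) : Ring.jacobson A ^ 3 = ⊥ := by
  rw [Submodule.pow_succ, Submodule.pow_succ, Submodule.pow_one, eq_bot_iff]
  refine Submodule.mul_le.2 fun r hr c hc => ?_
  refine Submodule.mul_induction_on hr (fun a ha b hb => ?_) fun x y hx hy => ?_
  · exact h.mul_mul_eq_zero a b c (fun i => char_eq_zero_of_mem_jacobson _ ha) (fun i => char_eq_zero_of_mem_jacobson _ hb)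
      fun i => char_eq_zero_of_mem_jacobson _ hc
  · rw [add_mul]
    exact Submodule.add_mem _ hx hy

theorem eq_zero_of_idempotent (h : FrobeniusData k e χ lam π) {f : A} (hf : f * f = f)
    (hχ : ∀ i, χ i f = 0) : f = 0 := by
  have := h.mul_mul_eq_zero f f f hχ hχ hχ
  rwa [hf, hf] at this

theorem mem_rightProj_iff (h : FrobeniusData k e χ lam π) (i : ι) (a : A) :
    a ∈ rightProj (e i) ↔ e i * a = a := by
  rw [Submodule.mem_span_singleton]
  constructor
  · rintro ⟨r, rfl⟩
    rw [MulOpposite.smul_eq_mul_unop, ← mul_assoc, h.idem]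
  · exact fun ha => ⟨MulOpposite.op a, ha⟩

theorem mem_leftProj_iff (h : FrobeniusData k e χ lam π) (i : ι) (a : A) :
    a ∈ leftProj (e i) ↔ a * e i = a := by
  rw [Submodule.mem_span_singleton]
  constructor
  · rintro ⟨r, rfl⟩
    rw [smul_eq_mul, mul_assoc, h.idem]
  · exact fun ha => ⟨a, ha⟩

theorem isBasicSystem (h : FrobeniusData k e χ lam π) : IsBasicSystem e where
  complete := h.complete
  ne_zero i hi := by simpa [hi] using h.char_self i
  primitive i f g hf hg hfg hgf hi := by
    have hone : χ i f + χ i g = 1 := by rw [← map_add, ← hi, h.char_self]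
    -- The other characters kill `f' = f' * e i` anyway; once `χ i` does too, `f'` is an idempotent
    -- with zero cube.
    have key : ∀ f' g' : A, f' * f' = f' → f' * g' = 0 → e i = f' + g' → χ i f' = 0 → f' = 0 := by
      intro f' g' hf' hfg' hi' h0
      refine h.eq_zero_of_idempotent hf' fun j => ?_
      by_cases hj : j = i
      · rw [hj, h0]
      · have : f' * e i = f' := by rw [hi', mul_add, hf', hfg', add_zero]
        rw [← this, map_mul, h.char_ne hj, mul_zero]
    rcases mul_eq_zero.1 (by rw [← map_mul, hfg, map_zero] : χ i f * χ i g = 0) with h0 | h0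
    · exact .inl (key f g hf hfg hi h0)
    · exact .inr (key g f hg hgf (hi.trans (add_comm _ _)) h0)
  not_iso i j := by
    rintro ⟨φ⟩
    by_contra hij
    let m : rightProj (e i) := ⟨e i, (h.mem_rightProj_iff i _).2 (h.idem i)⟩
    let m' : rightProj (e j) := ⟨e j, (h.mem_rightProj_iff j _).2 (h.idem j)⟩
    have hφ : e j * (φ m : A) = φ m := (h.mem_rightProj_iff j _).1 (φ m).2
    have h1 : φ m = MulOpposite.op (φ m : A) • m' := Subtype.ext hφ.symm
    have h2 : m = MulOpposite.op (φ m : A) • φ.symm m' := by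
      rw [← map_smul, ← h1, φ.symm_apply_apply]
    -- The isomorphism makes `e i` a product whose right factor lies in `e j A`, and `χ i` kills
    -- that factor.
    have h3 : e i = (φ.symm m' : A) * (φ m : A) := congrArg Subtype.val h2
    have h4 := congrArg (χ i) h3
    rw [h.char_self, ← hφ, map_mul, map_mul, h.char_ne hij, zero_mul, mul_zero] at h4
    exact one_ne_zero h4

/-- Splits off the part of `a` in the common kernel of the characters; modulo this nilpotent part
only multiples of the idempotents remain. -/
theorem sum_char_sub (h : FrobeniusData k e χ lam π) (a : A) (i : ι) :
    χ i (a - ∑ j, χ j a • e j) = 0 := by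
  rw [map_sub, map_sum, Finset.sum_eq_single i, map_smul, h.char_self, smul_eq_mul, mul_one,
    sub_self]
  · intro j _ hj
    rw [map_smul, h.char_ne hj.symm, smul_zero]
  · simp

/-- An element of `e i + rad A` is invertible modulo the other idempotents, from both sides. -/
theorem exists_inverse (h : FrobeniusData k e χ lam π) {i : ι} {a : A} (ha : χ i a ≠ 0) :
    (e i * a = a → ∃ b, a * b = e i) ∧ (a * e i = a → ∃ b, b * a = e i) := by
  -- Up to a scalar the corner of `a` is `e i - z` with `z` of cube zero, so the finite geometric
  -- series `e i + z + z * z` inverts it.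
  let z := e i - (χ i a)⁻¹ • (e i * a * e i)
  have hz : ∀ j, χ j z = 0 := fun j => by
    by_cases hj : j = i
    · subst hj
      simp [z, h.char_self, ha]
    · simp [z, h.char_ne hj]
  have hz3 := h.mul_mul_eq_zero z z z hz hz hz
  have hez : e i * z = z := by simp [z, mul_sub, ← mul_assoc, h.idem]
  have hze : z * e i = z := by simp [z, sub_mul, mul_assoc, h.idem]
  have hy : (χ i a)⁻¹ • (e i * a * e i) = e i - z := by simp [z]
  constructor
  · intro hea
    refine ⟨(χ i a)⁻¹ • (e i * (e i + z + z * z)), ?_⟩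
    rw [mul_smul_comm, ← mul_assoc, ← smul_mul_assoc]
    rw [hea] at hy
    rw [hy]
    simp only [sub_mul, mul_add, h.idem, hez, hze, ← mul_assoc, hz3]
    abel
  · intro hae
    refine ⟨(χ i a)⁻¹ • ((e i + z + z * z) * e i), ?_⟩
    rw [mul_assoc] at hy
    rw [smul_mul_assoc, mul_assoc, ← mul_smul_comm]
    rw [hae] at hy
    rw [hy]
    simp only [mul_sub, add_mul, h.idem, hze, hez, mul_assoc]
    rw [← mul_assoc z z z, hz3]
    abel

/-- The character of the opposite algebra. -/
def opChar (f : A →ₐ[k] k) : Aᵐᵒᵖ →+* k := (f : A →+* k).fromOpposite fun _ _ => Commute.all _ _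

theorem opChar_apply (f : A →ₐ[k] k) (a : Aᵐᵒᵖ) : opChar f a = f a.unop := rfl

instance (f : A →ₐ[k] k) : (RingHom.ker (opChar f)).IsMaximal :=
  RingHom.ker_isMaximal_of_surjective _ fun c =>
    ⟨MulOpposite.op (algebraMap k A c), by simp [opChar_apply]⟩

instance (f : A →ₐ[k] k) : (RingHom.ker f).IsMaximal :=
  RingHom.ker_isMaximal_of_surjective _ fun c => ⟨algebraMap k A c, by simp⟩

/-- Tops and socles are both compared with the quotient by the kernel of a character, which serves
as the common model of the simple module. -/
theorem top_rightProj (h : FrobeniusData k e χ lam π) (i : ι) :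
    Nonempty (Top Aᵐᵒᵖ (rightProj (e i)) ≃ₗ[Aᵐᵒᵖ] Aᵐᵒᵖ ⧸ RingHom.ker (opChar (χ i))) := by
  refine top_equiv_quotient ⟨e i, (h.mem_rightProj_iff i _).2 (h.idem i)⟩ _ ?_
    (Ideal.IsMaximal.ne_top inferInstance) ?_ ?_
  · rintro ⟨a, ha⟩
    exact ⟨MulOpposite.op a, Subtype.ext ((h.mem_rightProj_iff i a).1 ha)⟩
  · intro r hr
    have h1 : e i * r.unop = 0 := congrArg Subtype.val hr
    have h2 := congrArg (χ i) h1
    rw [RingHom.mem_ker]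
    simpa [h.char_self, opChar_apply] using h2
  · intro r hr
    obtain ⟨b, hb⟩ := (h.exists_inverse (i := i) (a := e i * r.unop) (by
      rw [map_mul, h.char_self, one_mul]; exact hr)).1 (by rw [← mul_assoc, h.idem])
    exact ⟨MulOpposite.op b, Subtype.ext hb⟩

theorem top_leftProj (h : FrobeniusData k e χ lam π) (i : ι) :
    Nonempty (Top A (leftProj (e i)) ≃ₗ[A] A ⧸ RingHom.ker (χ i)) := by
  refine top_equiv_quotient ⟨e i, (h.mem_leftProj_iff i _).2 (h.idem i)⟩ _ ?_
    (Ideal.IsMaximal.ne_top inferInstance) ?_ ?_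
  · rintro ⟨a, ha⟩
    exact ⟨a, Subtype.ext ((h.mem_leftProj_iff i a).1 ha)⟩
  · intro r hr
    have h1 : r * e i = 0 := congrArg Subtype.val hr
    have h2 := congrArg (χ i) h1
    rw [RingHom.mem_ker]
    simpa [h.char_self, opChar_apply] using h2
  · intro r hr
    obtain ⟨b, hb⟩ := (h.exists_inverse (i := i) (a := r * e i) (by
      rw [map_mul, h.char_self, mul_one]; exact hr)).2 (by rw [mul_assoc, h.idem])
    exact ⟨b, Subtype.ext hb⟩

/-- By `twist` the factor `e i` moves to the right end as `e (π i)`, where it meets the orthogonal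
`e j`. -/
theorem lam_eq_zero (h : FrobeniusData k e χ lam π) {i j : ι} (hij : j ≠ π i) (a : A) :
    lam (e i * a * e j) = 0 := by
  rw [mul_assoc, h.twist, mul_assoc, h.complete.ortho hij, mul_zero, map_zero]

/-- The socle is spanned by the `w` with `lam (w * a) = χ (π i) a`: nondegeneracy makes `A` act on
`w` through `χ (π i)`, and `twist` puts `w` into `e i A`. A generator `s` of a simple submodule is
killed by the common kernel of the characters, so `lam (s * ·)` is a multiple of `χ (π i)`, and `s`
is a multiple of `w`. -/
theorem socle_rightProj (h : FrobeniusData k e χ lam π) (i : ι) :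
    Nonempty (socle Aᵐᵒᵖ (rightProj (e i)) ≃ₗ[Aᵐᵒᵖ] Aᵐᵒᵖ ⧸ RingHom.ker (opChar (χ (π i)))) := by
  obtain ⟨w, hw⟩ := h.exists_left (χ (π i)).toLinearMap
  replace hw : ∀ a, lam (w * a) = χ (π i) a := fun a => (hw a).symm
  have hwa : ∀ a, w * a = χ (π i) a • w := fun a => by
    refine sub_eq_zero.1 (h.nondeg_left _ fun b => ?_)
    rw [sub_mul, map_sub, mul_assoc, hw, smul_mul_assoc, map_smul, hw, map_mul, smul_eq_mul,
      sub_self]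
  have hew : ∀ j, j ≠ i → e j * w = 0 := fun j hj => h.nondeg_left _ fun b => by
    rw [mul_assoc, h.twist, mul_assoc, hw, map_mul, h.char_ne (fun H => hj (π.injective H).symm),
      mul_zero]
  have hiw : e i * w = w := by
    have := congrArg (· * w) h.complete.complete
    simp only [Finset.sum_mul, one_mul] at this
    rwa [Finset.sum_eq_single i (fun j _ hj => hew j hj) (by simp)] at this
  have hw0 : w ≠ 0 := fun h0 => by
    have := hw 1
    rw [h0, zero_mul, map_zero, map_one] at this
    exact zero_ne_one this
  refine socle_equiv_quotient ⟨w, (h.mem_rightProj_iff i w).2 hiw⟩ _ ?_ ?_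
  · intro r
    rw [RingHom.mem_ker, opChar_apply, Subtype.ext_iff]
    change w * r.unop = 0 ↔ _
    rw [hwa, smul_eq_zero, or_iff_left hw0]
  · rintro ⟨s, hs⟩ hs0 hsimple
    have his := (h.mem_rightProj_iff i s).1 hs
    -- Otherwise simplicity gives `s = s * (j * r)`, and three iterations reach a zero product.
    have hJ : ∀ j, (∀ x, χ x j = 0) → s * j = 0 := by
      intro j hj
      by_contra h0
      obtain ⟨r, hr⟩ := hsimple (MulOpposite.op j) fun H => h0 (congrArg Subtype.val H)
      have hr' : s * j * r.unop = s := congrArg Subtype.val hr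
      have hjr : ∀ x, χ x (j * r.unop) = 0 := fun x => by rw [map_mul, hj, zero_mul]
      have hz := h.mul_mul_eq_zero _ _ _ hjr hjr hjr
      have h1 : s * (j * r.unop) = s := by rw [← mul_assoc, hr']
      have h2 : s = s * (j * r.unop * (j * r.unop) * (j * r.unop)) := by
        rw [← mul_assoc s, ← mul_assoc s, h1, h1, h1]
      rw [hz, mul_zero] at h2
      exact hs0 (Subtype.ext h2)
    have hsa : ∀ a, lam (s * a) = χ (π i) a * lam (s * e (π i)) := by
      intro a
      have h1 := hJ _ (h.sum_char_sub a)
      rw [mul_sub, sub_eq_zero] at h1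
      rw [h1, Finset.mul_sum, map_sum, Finset.sum_eq_single (π i)]
      · rw [mul_smul_comm, map_smul, smul_eq_mul]
      · intro j _ hj
        rw [mul_smul_comm, map_smul, ← his, h.lam_eq_zero hj, smul_zero]
      · simp
    refine ⟨MulOpposite.op (algebraMap k A (lam (s * e (π i)))), Subtype.ext ?_⟩
    refine sub_eq_zero.1 (h.nondeg_left _ fun b => ?_)
    change lam ((w * algebraMap k A _ - s) * b) = 0
    rw [sub_mul, map_sub, mul_assoc, hw, hsa b, map_mul, AlgHom.commutes, mul_comm,
      Algebra.algebraMap_self, RingHom.id_apply, sub_self]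

/-- Mirror image of `socle_rightProj`. Now `lam (a * w) = χ i a`, and `twist` places `w` in `A e (π
i)`, so the permutation runs backwards. -/
theorem socle_leftProj (h : FrobeniusData k e χ lam π) (i : ι) :
    Nonempty (socle A (leftProj (e (π i))) ≃ₗ[A] A ⧸ RingHom.ker (χ i)) := by
  obtain ⟨w, hw⟩ := h.exists_right (χ i).toLinearMap
  replace hw : ∀ a, lam (a * w) = χ i a := fun a => (hw a).symm
  have hwa : ∀ a, a * w = χ i a • w := fun a => by
    refine sub_eq_zero.1 (h.nondeg _ fun b => ?_)
    rw [mul_sub, map_sub, ← mul_assoc, hw, mul_smul_comm, map_smul, hw, map_mul, smul_eq_mul,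
      mul_comm, sub_self]
  have hew : ∀ j, j ≠ i → w * e (π j) = 0 := fun j hj => h.nondeg _ fun b => by
    rw [← mul_assoc, ← h.twist, ← mul_assoc, hw, map_mul, h.char_ne hj.symm, zero_mul]
  have hiw : w * e (π i) = w := by
    have := congrArg (w * ·) h.complete.complete
    simp only [Finset.mul_sum, mul_one] at this
    rwa [← π.sum_comp _ (fun j => w * e j) (by simp),
      Finset.sum_eq_single i (fun j _ hj => hew j hj) (by simp)] at this
  have hw0 : w ≠ 0 := fun h0 => by
    have := hw 1
    rw [h0, mul_zero, map_zero, map_one] at this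
    exact zero_ne_one this
  refine socle_equiv_quotient ⟨w, (h.mem_leftProj_iff _ w).2 hiw⟩ _ ?_ ?_
  · intro r
    rw [RingHom.mem_ker, Subtype.ext_iff]
    change r * w = 0 ↔ _
    rw [hwa, smul_eq_zero, or_iff_left hw0]
  · rintro ⟨s, hs⟩ hs0 hsimple
    have his := (h.mem_leftProj_iff _ s).1 hs
    have hJ : ∀ j, (∀ x, χ x j = 0) → j * s = 0 := by
      intro j hj
      by_contra h0
      obtain ⟨r, hr⟩ := hsimple j fun H => h0 (congrArg Subtype.val H)
      have hr' : r * (j * s) = s := congrArg Subtype.val hr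
      have hjr : ∀ x, χ x (r * j) = 0 := fun x => by rw [map_mul, hj, mul_zero]
      have hz := h.mul_mul_eq_zero _ _ _ hjr hjr hjr
      have h1 : r * j * s = s := by rw [mul_assoc, hr']
      have h2 : s = r * j * (r * j) * (r * j) * s := by
        rw [mul_assoc, mul_assoc, h1, h1, h1]
      rw [hz, zero_mul] at h2
      exact hs0 (Subtype.ext h2)
    have hsa : ∀ a, lam (a * s) = χ i a * lam (e i * s) := by
      intro a
      have h1 := hJ _ (h.sum_char_sub a)
      rw [sub_mul, sub_eq_zero] at h1
      rw [h1, Finset.sum_mul, map_sum, Finset.sum_eq_single i]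
      · rw [smul_mul_assoc, map_smul, smul_eq_mul]
      · intro j _ hj
        rw [smul_mul_assoc, map_smul, ← his, ← mul_assoc,
          h.lam_eq_zero (fun H => hj (π.injective H).symm), smul_zero]
      · simp
    refine ⟨algebraMap k A (lam (e i * s)), Subtype.ext ?_⟩
    refine sub_eq_zero.1 (h.nondeg _ fun b => ?_)
    change lam (b * (algebraMap k A _ * w - s)) = 0
    rw [mul_sub, map_sub, ← mul_assoc, hw, hsa b, map_mul, AlgHom.commutes,
      Algebra.algebraMap_self, RingHom.id_apply, sub_self]

theorem isNakayamaPermutation (h : FrobeniusData k e χ lam π) :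
    IsNakayamaPermutation e π := fun i => by
  obtain ⟨f⟩ := h.socle_rightProj i
  obtain ⟨g⟩ := h.top_rightProj (π i)
  exact ⟨f.trans g.symm⟩

theorem isLeftNakayamaPermutation (h : FrobeniusData k e χ lam π) :
    IsLeftNakayamaPermutation e π.symm := fun i => by
  obtain ⟨f⟩ := h.socle_leftProj (π.symm i)
  obtain ⟨g⟩ := h.top_leftProj (π.symm i)
  rw [π.apply_symm_apply] at f
  exact ⟨f.trans g.symm⟩

end FrobeniusData

/-! ### Coefficients of the morphisms, for a quiver of height one without parallel paths -/

section Coefficients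

variable {k : Type u} [Field k] {V : Type} [Quiver.{0} V]

/-- There is a path from `x` to `y`. -/
def HasPath (x y : PathCategory k V) : Prop := Nonempty (Quiver.Path (V := V) x y)

/-- The sum of the coefficients of a linear combination of paths. -/
noncomputable def pathCoeff (x y : PathCategory k V) : (x ⟶ y) →ₗ[k] k :=
  Finsupp.linearCombination k (fun _ : Quiver.Path (V := V) x y => (1 : k))

/-- A path, as a morphism of the path category. -/
noncomputable def pathHom {x y : PathCategory k V} (p : Quiver.Path (V := V) x y) : x ⟶ y :=
  Finsupp.single (M := k) p 1

theorem pathCoeff_single {x y : PathCategory k V} (p : Quiver.Path (V := V) x y) (c : k) :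
    pathCoeff x y (Finsupp.single p c) = c :=
  (Finsupp.linearCombination_single k c p).trans (mul_one c)

theorem pathCoeff_pathHom {x y : PathCategory k V} (p : Quiver.Path (V := V) x y) :
    pathCoeff x y (pathHom p) = 1 := pathCoeff_single p 1

theorem pathHom_induction {x y : PathCategory k V} {P : (x ⟶ y) → Prop} (f : x ⟶ y)
    (h0 : P 0) (hadd : ∀ f g, P f → P g → P (f + g)) (hsmul : ∀ (c : k) p, P (c • pathHom p)) :
    P f := by
  refine Finsupp.induction_linear (M := k) (motive := P) f h0 hadd fun p c => ?_
  have : c • pathHom p = (Finsupp.single (M := k) p c : Quiver.Path (V := V) x y →₀ k) := by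
    refine (Finsupp.smul_single (M := k) c p 1).trans ?_
    rw [smul_eq_mul, mul_one]
  exact this ▸ hsmul c p

theorem pathCoeff_id (x : PathCategory k V) : pathCoeff x x (𝟙 x) = 1 :=
  pathCoeff_pathHom Quiver.Path.nil

theorem pathHom_comp {x y z : PathCategory k V} (p : Quiver.Path (V := V) x y)
    (q : Quiver.Path (V := V) y z) : pathHom p ≫ pathHom q = pathHom (k := k) (p.comp q) := by
  refine (Free.single_comp_single k (C := Paths V) p q 1 1).trans ?_
  rw [mul_one]
  rfl

/-- Paths compose to paths, so the sum of coefficients is multiplicative; this needs no uniqueness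
of paths. -/
theorem pathCoeff_comp {x y z : PathCategory k V} (f : x ⟶ y) (g : y ⟶ z) :
    pathCoeff x z (f ≫ g) = pathCoeff x y f * pathCoeff y z g := by
  refine pathHom_induction
    (P := fun f => pathCoeff x z (f ≫ g) = pathCoeff x y f * pathCoeff y z g) f (by simp) (fun f₁ f₂ h₁ h₂ => ?_) fun c p => ?_
  · rw [Preadditive.add_comp, map_add, h₁, h₂, map_add, add_mul]
  · refine pathHom_induction (P := fun g => pathCoeff x z ((c • pathHom p) ≫ g) =
      pathCoeff x y (c • pathHom p) * pathCoeff y z g) g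
      (by simp) (fun g₁ g₂ h₁ h₂ => ?_) fun d q => ?_
    · rw [Preadditive.comp_add, map_add, h₁, h₂, map_add, mul_add]
    · rw [Linear.smul_comp, Linear.comp_smul, pathHom_comp]
      simp [pathCoeff_pathHom]

theorem pathCoeff_mapHom (s : QuiverAut V) {x y : PathCategory k V} (f : x ⟶ y) :
    pathCoeff _ _ ((s.linearize k).functor.map f) = pathCoeff x y f := by
  refine pathHom_induction
    (P := fun f => pathCoeff _ _ ((s.linearize k).functor.map f) = pathCoeff x y f) f (by rw [LinearAut.map_zero, map_zero, map_zero])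
    (fun f g hf hg => ?_) fun c p => ?_
  · rw [(s.linearize k).map_add, map_add, hf, hg, map_add]
  · rw [(s.linearize k).map_smul, map_smul, map_smul, pathCoeff_pathHom]
    congr 1
    exact (congrArg (pathCoeff _ _) (s.mapHom_single k x y p 1)).trans (pathCoeff_single _ _)

open Classical in
/-- The coefficient of a functional on the linear combinations of paths. -/
noncomputable def dualCoeff (x y : PathCategory k V) : Module.Dual k (x ⟶ y) →ₗ[k] k where
  -- The choice of path is immaterial once parallel paths coincide.
  toFun φ := if h : HasPath x y then φ (pathHom h.some) else 0
  map_add' φ ψ := by split_ifs <;> simp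
  map_smul' c φ := by split_ifs <;> simp

theorem dualCoeff_of_not {x y : PathCategory k V} (h : ¬ HasPath x y)
    (φ : Module.Dual k (x ⟶ y)) : dualCoeff x y φ = 0 := dif_neg h

/-- The coefficient of a morphism of the repetition. -/
noncomputable def coeff (X Y : Repetition k (PathCategory k V)) : (X ⟶ Y) →ₗ[k] k where
  -- The levels allow at most one of the two summands to be nonzero.
  toFun f := pathCoeff _ _ (Repetition.homFst f) + dualCoeff _ _ (Repetition.homSnd f)
  map_add' f g := by simp; ring
  map_smul' c f := by simp; ring

theorem coeff_apply {X Y : Repetition k (PathCategory k V)} (f : X ⟶ Y) : coeff X Y f =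
    pathCoeff _ _ (Repetition.homFst f) + dualCoeff _ _ (Repetition.homSnd f) := rfl

/-- The pairs of objects of the repetition with a nonzero morphism. -/
def Rel (X Y : Repetition k (PathCategory k V)) : Prop :=
  (Y.level = X.level ∧ HasPath X.base Y.base) ∨ (Y.level = X.level + 1 ∧ HasPath Y.base X.base)

theorem rel_refl (X : Repetition k (PathCategory k V)) : Rel X X := .inl ⟨rfl, ⟨.nil⟩⟩

theorem rel_finite [Finite V] (X : Repetition k (PathCategory k V)) : {Y | Rel X Y}.Finite := by
  refine ((Set.finite_range fun y : V => (⟨y, X.level⟩ : Repetition k (PathCategory k V))).union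
    (Set.finite_range fun y : V => ⟨y, X.level + 1⟩)).subset ?_
  rintro ⟨y, l⟩ (⟨h, -⟩ | ⟨h, -⟩)
  · exact .inl ⟨y, Repetition.ext rfl h.symm⟩
  · exact .inr ⟨y, Repetition.ext rfl h.symm⟩

theorem rel_finite' [Finite V] (Y : Repetition k (PathCategory k V)) : {X | Rel X Y}.Finite := by
  refine ((Set.finite_range fun y : V => (⟨y, Y.level⟩ : Repetition k (PathCategory k V))).union
    (Set.finite_range fun y : V => ⟨y, Y.level - 1⟩)).subset ?_
  rintro ⟨y, l⟩ (⟨h, -⟩ | ⟨h, -⟩)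
  · exact .inl ⟨y, Repetition.ext rfl h⟩
  · exact .inr ⟨y, Repetition.ext rfl (by dsimp only at h ⊢; omega)⟩

theorem eq_zero_of_not_hasPath {x y : PathCategory k V} (h : ¬ HasPath x y) (f : x ⟶ y) :
    f = 0 := by
  refine pathHom_induction (P := fun f => f = 0) f rfl (fun f g hf hg => ?_) fun c q => (h ⟨q⟩).elim
  rw [hf, hg, add_zero]

theorem coeff_id (X : Repetition k (PathCategory k V)) : coeff X X (𝟙 X) = 1 := by
  rw [coeff_apply, Repetition.homFst_id, Repetition.homSnd_id, pathCoeff_id, map_zero, add_zero]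

theorem coeff_eq_zero {X Y : Repetition k (PathCategory k V)} (h : ¬ Rel X Y) (f : X ⟶ Y) :
    coeff X Y f = 0 := by
  simp only [Rel, not_or, not_and] at h
  rw [coeff_apply]
  have h1 : Repetition.homFst f = 0 := by
    by_cases hl : Y.level = X.level
    · exact eq_zero_of_not_hasPath (h.1 hl) _
    · exact Repetition.homFst_eq_zero f hl
  have h2 : dualCoeff _ _ (Repetition.homSnd f) = 0 := by
    by_cases hl : Y.level = X.level + 1
    · exact dualCoeff_of_not (h.2 hl) _
    · rw [Repetition.homSnd_eq_zero f hl, map_zero]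
  rw [h1, h2, map_zero, add_zero]

variable [hV : ∀ a b : V, Subsingleton (Quiver.Path a b)]

theorem eq_smul_pathHom {x y : PathCategory k V} (p : Quiver.Path (V := V) x y) (f : x ⟶ y) :
    f = pathCoeff x y f • pathHom p := by
  refine pathHom_induction (P := fun f => f = pathCoeff x y f • pathHom p) f (by simp)
    (fun f g hf hg => ?_) fun c q => ?_
  · rw [map_add, add_smul, ← hf, ← hg]
  · rw [map_smul, pathCoeff_pathHom, (hV x y).elim q p, smul_eq_mul, mul_one]

theorem pathCoeff_injective {x y : PathCategory k V} {f g : x ⟶ y}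
    (h : pathCoeff x y f = pathCoeff x y g) : f = g := by
  by_cases hp : HasPath x y
  · obtain ⟨p⟩ := hp
    rw [eq_smul_pathHom p f, h, ← eq_smul_pathHom p g]
  · rw [eq_zero_of_not_hasPath hp f, eq_zero_of_not_hasPath hp g]

theorem dualCoeff_of_path {x y : PathCategory k V} (p : Quiver.Path (V := V) x y)
    (φ : Module.Dual k (x ⟶ y)) : dualCoeff x y φ = φ (pathHom p) := by
  have h : HasPath x y := ⟨p⟩
  rw [(hV x y).elim p h.some]
  exact dif_pos h

theorem dual_apply {x y : PathCategory k V} (φ : Module.Dual k (x ⟶ y)) (f : x ⟶ y) :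
    φ f = dualCoeff x y φ * pathCoeff x y f := by
  by_cases hp : HasPath x y
  · obtain ⟨p⟩ := hp
    rw [dualCoeff_of_path p, eq_smul_pathHom p f, map_smul, map_smul, pathCoeff_pathHom]
    simp [mul_comm]
  · rw [eq_zero_of_not_hasPath hp f, map_zero, map_zero, mul_zero]

/-- At equal levels only the path component survives, otherwise only the dual one, and uniqueness of
paths makes each determined by its coefficient. -/
theorem coeff_injective {X Y : Repetition k (PathCategory k V)} {f : X ⟶ Y}
    (h : coeff X Y f = 0) : f = 0 := by
  rw [coeff_apply] at h
  by_cases hl : Y.level = X.level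
  · have h2 := Repetition.homSnd_eq_zero f (by omega)
    rw [h2, map_zero, add_zero] at h
    exact Repetition.hom_ext (pathCoeff_injective (h.trans (map_zero _).symm)) h2
  · have h1 := Repetition.homFst_eq_zero f hl
    rw [h1, map_zero, zero_add] at h
    refine Repetition.hom_ext h1 (LinearMap.ext fun g => ?_)
    rw [dual_apply, h, zero_mul]
    rfl

theorem exists_coeff_eq_one {X Y : Repetition k (PathCategory k V)} (h : Rel X Y) :
    ∃ f : X ⟶ Y, coeff X Y f = 1 := by
  obtain ⟨hl, ⟨p⟩⟩ | ⟨hl, ⟨p⟩⟩ := h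
  · refine ⟨Repetition.homMk (pathHom p) 0 (fun h => (h hl).elim) fun _ => rfl, ?_⟩
    rw [coeff_apply, Repetition.homFst_homMk, Repetition.homSnd_homMk, pathCoeff_pathHom,
      map_zero, add_zero]
  · refine ⟨Repetition.homMk 0 (pathCoeff _ _) (fun _ => rfl) (fun h => (h hl).elim), ?_⟩
    rw [coeff_apply, Repetition.homFst_homMk, Repetition.homSnd_homMk, dualCoeff_of_path p,
      pathCoeff_pathHom, map_zero, zero_add]

/-- Parallel paths being equal, basis morphisms compose to the basis morphism from `X` to `Z`
whenever there is one. Without `Rel X Z` the formula fails: a nontrivial path x → y followed by the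
basis functional y^[0] → y^[1] can be zero. -/
theorem coeff_comp_of_rel {X Y Z : Repetition k (PathCategory k V)} (h : Rel X Z) (f : X ⟶ Y)
    (g : Y ⟶ Z) : coeff X Z (f ≫ g) = coeff X Y f * coeff Y Z g := by
  have hf1 := Repetition.homFst_eq_zero f
  have hf2 := Repetition.homSnd_eq_zero f
  have hg1 := Repetition.homFst_eq_zero g
  have hg2 := Repetition.homSnd_eq_zero g
  simp only [coeff_apply, Repetition.homFst_comp, Repetition.homSnd_comp, pathCoeff_comp]
  obtain ⟨hl, -⟩ | ⟨hl, ⟨p⟩⟩ := h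
  · by_cases hY : Y.level = X.level
    · rw [hf2 (by omega), hg2 (by omega)]
      have : Repetition.dualComp (0 : Module.Dual k (Y.base ⟶ X.base)) (Repetition.homFst g) +
          Repetition.compDual (Repetition.homFst f) (0 : Module.Dual k (Z.base ⟶ Y.base)) = 0 := by
        ext; simp
      rw [this]
      simp
    · rw [hf1 hY]
      by_cases hY' : Y.level = X.level + 1
      · rw [hg1 (by omega), hg2 (by omega)]
        have : Repetition.dualComp (Repetition.homSnd f) (0 : Y.base ⟶ Z.base) +
          Repetition.compDual (0 : X.base ⟶ Y.base) (0 : Module.Dual k (Z.base ⟶ Y.base)) = 0 := by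
          ext; simp
        rw [this]
        simp
      · rw [hf2 hY']
        have : Repetition.dualComp (0 : Module.Dual k (Y.base ⟶ X.base)) (Repetition.homFst g) +
          Repetition.compDual (0 : X.base ⟶ Y.base) (Repetition.homSnd g) = 0 := by
          ext; simp
        rw [this]
        simp
  -- With a level difference of one, the path-path and functional-functional products vanish, and
  -- only the mixed terms remain.
  · have h1 : pathCoeff _ _ (Repetition.homFst f) * pathCoeff _ _ (Repetition.homFst g) = 0 := by
      by_cases hY : Y.level = X.level
      · rw [hg1 (by omega), map_zero, mul_zero]
      · rw [hf1 hY, map_zero, zero_mul]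
    have h2 : dualCoeff _ _ (Repetition.homSnd f) * dualCoeff _ _ (Repetition.homSnd g) = 0 := by
      by_cases hY : Y.level = X.level + 1
      · rw [hg2 (by omega), map_zero, mul_zero]
      · rw [hf2 hY, map_zero, zero_mul]
    rw [dualCoeff_of_path p, LinearMap.add_apply, Repetition.dualComp_apply,
      Repetition.compDual_apply, dual_apply (Repetition.homSnd f),
      dual_apply (Repetition.homSnd g), pathCoeff_comp, pathCoeff_comp,
      pathCoeff_pathHom, h1, add_mul, mul_add, mul_add, h1, h2]
    ring

/-- A quiver automorphism permutes the paths, hence also the dual basis, and the level shift leaves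
the components alone. -/
theorem coeff_twist (s : QuiverAut V) (d : ℤ) {X Y : Repetition k (PathCategory k V)} (f : X ⟶ Y) :
    coeff _ _ ((twist (s.linearize k) d).functor.map f) = coeff X Y f := by
  have h1 : pathCoeff _ _ (Repetition.homFst ((twist (s.linearize k) d).functor.map f)) =
      pathCoeff _ _ (Repetition.homFst f) := pathCoeff_mapHom s _
  have h2 : dualCoeff _ _ (Repetition.homSnd ((twist (s.linearize k) d).functor.map f)) =
      dualCoeff _ _ (Repetition.homSnd f) := by
    let φ := (s.linearize k).homEquiv Y.base X.base
    have h3 : ∀ g, Repetition.homSnd ((twist (s.linearize k) d).functor.map f) g =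
      Repetition.homSnd f (φ.symm g) := fun g => rfl
    by_cases hp : HasPath Y.base X.base
    · obtain ⟨p⟩ := hp
      rw [dualCoeff_of_path p]
      have h4 := dual_apply (Repetition.homSnd ((twist (s.linearize k) d).functor.map f))
        (φ (pathHom p))
      replace h4 := ((h3 _).trans (congrArg _ (φ.symm_apply_apply _))).symm.trans h4
      rw [h4]
      have h5 : pathCoeff _ _ (φ (pathHom p)) = 1 :=
        (pathCoeff_mapHom s _).trans (pathCoeff_pathHom p)
      exact ((congrArg _ h5).trans (mul_one _)).symm
    · rw [dualCoeff_of_not hp]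
      have h4 : Repetition.homSnd ((twist (s.linearize k) d).functor.map f) = 0 := by
        refine LinearMap.ext fun g => (h3 g).trans ?_
        rw [eq_zero_of_not_hasPath hp (φ.symm g), map_zero]
        rfl
      rw [h4, map_zero]
  rw [coeff_apply, coeff_apply, h1, h2]

theorem rel_iff {X Y : Repetition k (PathCategory k V)} :
    Rel X Y ↔ ∃ f : X ⟶ Y, coeff X Y f ≠ 0 := by
  refine ⟨fun h => ?_, fun ⟨f, hf⟩ => by_contra fun h => hf (coeff_eq_zero h f)⟩
  obtain ⟨f, hf⟩ := exists_coeff_eq_one h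
  exact ⟨f, hf ▸ one_ne_zero⟩

theorem rel_twist (s : QuiverAut V) (d : ℤ) (X Y : Repetition k (PathCategory k V)) :
    Rel ((twist (s.linearize k) d).functor.obj X) ((twist (s.linearize k) d).functor.obj Y) ↔
      Rel X Y := by
  rw [rel_iff, rel_iff, ((twist (s.linearize k) d).map_bijective X Y).2.exists]
  simp only [coeff_twist]

end Coefficients

/-! ### The Frobenius form of the twisted extension -/

section Extension

variable {k : Type u} [Field k] {V : Type} [Quiver.{0} V]

/-- The action of the twist on the objects of the repetition. -/
noncomputable def twistPerm (s : QuiverAut V) (k : Type u) [Field k] (d : ℤ) :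
    Equiv.Perm (Repetition k (PathCategory k V)) :=
  Equiv.ofBijective _ (twist (s.linearize k) d).obj_bijective

variable {s : QuiverAut V} {d : ℤ}

theorem level_zpow (i : ℤ) (X : Repetition k (PathCategory k V)) :
    ((twistPerm s k d ^ i) X).level = X.level + i * d := by
  induction i using Int.induction_on generalizing X with
  | zero => simp
  | succ i ih =>
    rw [zpow_add_one, Equiv.Perm.mul_apply, ih]
    change X.level + d + i * d = _
    ring
  | pred i ih =>
    obtain ⟨Y, rfl⟩ := (twistPerm s k d).surjective X
    rw [zpow_sub_one, Equiv.Perm.mul_apply, Equiv.Perm.inv_def,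
      Equiv.symm_apply_apply, ih]
    change _ = Y.level + d + _
    ring

theorem mem_orbit_iff (X Y : Repetition k (PathCategory k V)) :
    Y ∈ OrbitAlgebra.orbit (twist (s.linearize k) d) X ↔
      ∃ i : ℤ, (twistPerm s k d ^ i) X = Y := by
  constructor
  · intro h
    induction h with
    | rel a b hab => exact ⟨1, by rw [zpow_one]; exact hab⟩
    | refl a => exact ⟨0, by simp⟩
    | symm a b _ ih =>
      obtain ⟨i, rfl⟩ := ih
      exact ⟨-i, by rw [← Equiv.Perm.mul_apply, ← zpow_add]; simp⟩
    | trans a b c _ _ ih₁ ih₂ =>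
      obtain ⟨i, rfl⟩ := ih₁
      obtain ⟨j, rfl⟩ := ih₂
      exact ⟨j + i, by rw [zpow_add, Equiv.Perm.mul_apply]⟩
  · have h1 : ∀ Z, twistPerm s k d Z ∈ OrbitAlgebra.orbit (twist (s.linearize k) d) Z :=
      fun Z => .rel _ _ rfl
    rintro ⟨i, rfl⟩
    induction i using Int.induction_on with
    | zero => exact .refl _
    | succ i ih =>
      rw [add_comm, zpow_one_add, Equiv.Perm.mul_apply]
      exact ih.trans _ _ _ (h1 _)
    | pred i ih =>
      refine ih.trans _ _ _ (.symm _ _ ?_)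
      have := h1 ((twistPerm s k d ^ (-(i : ℤ) - 1)) X)
      rwa [← Equiv.Perm.mul_apply, ← zpow_one_add, add_sub_cancel] at this

/-- The `i`-th power of the twist shifts levels by `i * d` with `d = ±1`, so an orbit meets each
level at most once. -/
theorem eq_of_mem_orbit (hd : d * d = 1) {X Y : Repetition k (PathCategory k V)}
    (h : Y ∈ OrbitAlgebra.orbit (twist (s.linearize k) d) X) (hl : X.level = Y.level) : X = Y := by
  obtain ⟨i, rfl⟩ := (mem_orbit_iff X Y).1 h
  rw [level_zpow] at hl
  have h0 : i * d * d = 0 := by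
    rw [show i * d = 0 by omega, zero_mul]
  rw [mul_assoc, hd, mul_one] at h0
  rw [h0, zpow_zero, Equiv.Perm.one_apply]

/-- As `d` is its own inverse, the exponent `(l - X.level) * d` gives the required shift: orbits
meet every level. -/
theorem exists_level (hd : d * d = 1) (l : ℤ) (X : Repetition k (PathCategory k V)) :
    ∃ i : ℤ, ((twistPerm s k d ^ i) X).level = l :=
  ⟨(l - X.level) * d, by rw [level_zpow, mul_assoc, hd]; ring⟩

/-- The matrices of coefficients of the elements of the twisted extension. -/
noncomputable def ent (X Y : Repetition k (PathCategory k V)) :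
    TwistedExtension (s.linearize k) d →ₗ[k] k where
  toFun f := coeff X Y (f.entry X Y)
  map_add' f g := by rw [OrbitAlgebra.entry_add, map_add]
  map_smul' c f := by rw [OrbitAlgebra.entry_smul, map_smul, RingHom.id_apply]

theorem ent_apply (f : TwistedExtension (s.linearize k) d) (X Y : Repetition k (PathCategory k V)) :
    ent X Y f = coeff X Y (f.entry X Y) := rfl

theorem ent_one (X : Repetition k (PathCategory k V)) :
    ent X X (1 : TwistedExtension (s.linearize k) d) = 1 := by
  rw [ent_apply, OrbitAlgebra.entry_one_self, coeff_id]

open Classical in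
theorem ent_idempotent (x : V) (X Y : Repetition k (PathCategory k V)) :
    ent X Y (vertexIdempotent (s.linearize k) d x) =
      if X = Y ∧ X ∈ OrbitAlgebra.orbit (twist (s.linearize k) d) ⟨x, 0⟩ then 1 else 0 := by
  change coeff X Y (dite (X = Y) _ _) = _
  by_cases h : X = Y
  · subst h
    by_cases hX : X ∈ OrbitAlgebra.orbit (twist (s.linearize k) d) ⟨x, 0⟩
    · rw [dif_pos rfl, if_pos hX, if_pos ⟨rfl, hX⟩, eqToHom_refl, coeff_id]
    · rw [dif_pos rfl, if_neg hX, if_neg fun h => hX h.2, map_zero]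
  · rw [dif_neg h, if_neg fun H => h H.1, map_zero]

theorem zpow_invariant {P : Repetition k (PathCategory k V) → Repetition k (PathCategory k V) → Prop}
    (T : Equiv.Perm (Repetition k (PathCategory k V))) (h : ∀ X Y, P (T X) (T Y) ↔ P X Y) (i : ℤ)
    (X Y) : P ((T ^ i) X) ((T ^ i) Y) ↔ P X Y := by
  induction i using Int.induction_on with
  | zero => rfl
  | succ i ih => rw [add_comm, zpow_one_add, Equiv.Perm.mul_apply, Equiv.Perm.mul_apply, h, ih]
  | pred i ih =>
    rw [← h, ← Equiv.Perm.mul_apply, ← Equiv.Perm.mul_apply, ← zpow_one_add, add_sub_cancel, ih]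

/-- The quiver has no paths of length two. -/
def HeightOne (V : Type) [Quiver.{0} V] : Prop :=
  ∀ a b c : V, Quiver.Path a b → Quiver.Path b c → a = b ∨ b = c

theorem HeightOne.eq_or (hV : HeightOne V) {x y z : PathCategory k V} (h : HasPath x y)
    (h' : HasPath y z) : x = y ∨ y = z := hV x y z h.some h'.some

theorem HeightOne.antisymm (hV : HeightOne V) {x y : PathCategory k V} (h : HasPath x y)
    (h' : HasPath y x) : x = y := (hV.eq_or h h').elim id Eq.symm

/-- By `Rel X W` the chain jumps at most one level. If the middle step is not the jump, two
consecutive steps without a jump give composable paths. If it is, `Rel X W` supplies a path w → x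
that closes up to composable paths z → w → x → y. -/
theorem HeightOne.eq_of_rel (hV : HeightOne V) {X Y Z W : Repetition k (PathCategory k V)}
    (h₁ : Rel X Y) (h₂ : Rel Y Z) (h₃ : Rel Z W) (h₄ : Rel X W) : X = Y ∨ Y = Z ∨ Z = W := by
  obtain ⟨x, i⟩ := X
  obtain ⟨y, i₁⟩ := Y
  obtain ⟨z, i₂⟩ := Z
  obtain ⟨w, i₃⟩ := W
  have eq : ∀ {x y : PathCategory k V} {i j : ℤ}, x = y → j = i →
      (⟨x, i⟩ : Repetition k (PathCategory k V)) = ⟨y, j⟩ := fun h h' => by rw [h, h']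
  simp only [Rel] at h₁ h₂ h₃ h₄
  rcases h₁ with ⟨l₁, p₁⟩ | ⟨l₁, p₁⟩ <;> rcases h₂ with ⟨l₂, p₂⟩ | ⟨l₂, p₂⟩
  · exact (hV.eq_or p₁ p₂).imp (fun h => eq h l₁) fun h => .inl (eq h l₂)
  · rcases h₃ with ⟨l₃, p₃⟩ | ⟨l₃, p₃⟩
    · rcases h₄ with ⟨l₄, p₄⟩ | ⟨l₄, p₄⟩
      · omega
      · rcases hV.eq_or p₃ p₄ with h | h
        · exact .inr (.inr (eq h l₃))
        · subst h
          exact (hV.eq_or p₃ p₁).elim (fun h => .inr (.inr (eq h l₃))) fun h => .inl (eq h l₁)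
    · rcases h₄ with ⟨l₄, p₄⟩ | ⟨l₄, p₄⟩ <;> omega
  · rcases h₃ with ⟨l₃, p₃⟩ | ⟨l₃, p₃⟩
    · exact .inr ((hV.eq_or p₂ p₃).imp (fun h => eq h l₂) fun h => eq h l₃)
    · rcases h₄ with ⟨l₄, p₄⟩ | ⟨l₄, p₄⟩ <;> omega
  · rcases h₃ with ⟨l₃, p₃⟩ | ⟨l₃, p₃⟩ <;> rcases h₄ with ⟨l₄, p₄⟩ | ⟨l₄, p₄⟩ <;> omega

/-- The Frobenius form: the sum of the values of the functionals at the identities. -/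
noncomputable def frobeniusForm [Fintype V] (s : QuiverAut V) (k : Type u) [Field k] (d : ℤ) :
    TwistedExtension (s.linearize k) d →ₗ[k] k :=
  ∑ x : V, ent ⟨x, 0⟩ ⟨x, 1⟩

theorem frobeniusForm_apply [Fintype V] (f : TwistedExtension (s.linearize k) d) :
    frobeniusForm s k d f = ∑ x : V, ent ⟨x, 0⟩ ⟨x, 1⟩ f :=
  LinearMap.sum_apply _ _ _

theorem rel_of_ent {f : TwistedExtension (s.linearize k) d} {X Y : Repetition k (PathCategory k V)}
    (h : ent X Y f ≠ 0) : Rel X Y := by_contra fun H => h (coeff_eq_zero H _)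

variable [hV : ∀ a b : V, Subsingleton (Quiver.Path a b)]

theorem ext_ent {f g : TwistedExtension (s.linearize k) d} (h : ∀ X Y, ent X Y f = ent X Y g) :
    f = g := OrbitAlgebra.ext fun X Y => sub_eq_zero.1 (coeff_injective (by
      rw [map_sub]
      exact sub_eq_zero.2 (h X Y)))

theorem ent_twist (f : TwistedExtension (s.linearize k) d)
    (X Y : Repetition k (PathCategory k V)) :
    ent (twistPerm s k d X) (twistPerm s k d Y) f = ent X Y f := by
  rw [ent_apply]
  exact (congrArg _ (f.entry_map X Y)).trans (coeff_twist s d _)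

theorem ent_zpow (f : TwistedExtension (s.linearize k) d) (i : ℤ)
    (X Y : Repetition k (PathCategory k V)) :
    ent ((twistPerm s k d ^ i) X) ((twistPerm s k d ^ i) Y) f = ent X Y f :=
  (zpow_invariant (P := fun X' Y' => ent X' Y' f = ent X Y f) _
    (fun X' Y' => by rw [ent_twist]) i X Y).2 rfl

theorem rel_zpow (i : ℤ) (X Y : Repetition k (PathCategory k V)) :
    Rel ((twistPerm s k d ^ i) X) ((twistPerm s k d ^ i) Y) ↔ Rel X Y :=
  zpow_invariant _ (fun X' Y' => rel_twist s d X' Y') i X Y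

theorem ent_mul (g f : TwistedExtension (s.linearize k) d)
    {X Z : Repetition k (PathCategory k V)} (h : Rel X Z) :
    ent X Z (g * f) = ∑ᶠ Y, ent X Y f * ent Y Z g := by
  have hfin := (f.finite_left X).subset (OrbitAlgebra.support_comp_left g f X Z)
  rw [ent_apply, OrbitAlgebra.entry_mul]
  refine ((coeff X Z).toAddMonoidHom.map_finsum hfin).trans ?_
  exact finsum_congr fun Y => coeff_comp_of_rel h _ _

open Classical in
theorem ent_idempotent_mul (x : V) (f : TwistedExtension (s.linearize k) d)
    (X Y : Repetition k (PathCategory k V)) :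
    ent X Y (vertexIdempotent (s.linearize k) d x * f) =
      if Y ∈ OrbitAlgebra.orbit (twist (s.linearize k) d) ⟨x, 0⟩ then ent X Y f else 0 := by
  by_cases h : Rel X Y
  · rw [ent_mul _ _ h, finsum_eq_single _ Y, ent_idempotent]
    · simp
    · intro Z hZ
      rw [ent_idempotent, if_neg fun H => hZ H.1, mul_zero]
  · rw [not_imp_comm.1 rel_of_ent h, not_imp_comm.1 rel_of_ent h, ite_self]

open Classical in
theorem ent_mul_idempotent (x : V) (f : TwistedExtension (s.linearize k) d)
    (X Y : Repetition k (PathCategory k V)) :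
    ent X Y (f * vertexIdempotent (s.linearize k) d x) =
      if X ∈ OrbitAlgebra.orbit (twist (s.linearize k) d) ⟨x, 0⟩ then ent X Y f else 0 := by
  by_cases h : Rel X Y
  · rw [ent_mul _ _ h, finsum_eq_single _ X, ent_idempotent]
    · simp
    · intro Z hZ
      rw [ent_idempotent, if_neg fun H => hZ H.1.symm, zero_mul]
  · rw [not_imp_comm.1 rel_of_ent h, not_imp_comm.1 rel_of_ent h, ite_self]

open Classical in
/-- An element of the twisted extension with prescribed support. -/
theorem exists_ent [Finite V]
    (S : Repetition k (PathCategory k V) → Repetition k (PathCategory k V) → Prop)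
    (hS : ∀ X Y, S X Y → Rel X Y) (hinv : ∀ X Y, S (twistPerm s k d X) (twistPerm s k d Y) ↔ S X Y) :
    ∃ f : TwistedExtension (s.linearize k) d, ∀ X Y, ent X Y f = if S X Y then 1 else 0 := by
  choose b hb using fun X Y (h : S X Y) => exists_coeff_eq_one (hS X Y h)
  have hne : ∀ X Y, (if h : S X Y then b X Y h else 0) ≠ 0 → S X Y := fun X Y h =>
    by_contra fun H => h (dif_neg H)
  refine ⟨⟨fun X Y => if h : S X Y then b X Y h else 0,
    fun X => (rel_finite X).subset fun Y hY => hS X Y (hne X Y hY),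
    fun Y => (rel_finite' Y).subset fun X hX => hS X Y (hne X Y hX), fun X Y => ?_⟩, fun X Y => ?_⟩
  · refine sub_eq_zero.1 (coeff_injective ?_)
    rw [map_sub, coeff_twist, sub_eq_zero]
    by_cases h : S X Y
    · have h' := (hinv X Y).2 h
      exact ((congrArg (coeff _ _) (dif_pos h')).trans (hb _ _ h')).trans
        ((congrArg (coeff _ _) (dif_pos h)).trans (hb _ _ h)).symm
    · have h' : ¬ S (twistPerm s k d X) (twistPerm s k d Y) := fun H => h ((hinv X Y).1 H)
      exact ((congrArg (coeff _ _) (dif_neg h')).trans (map_zero _)).trans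
        ((congrArg (coeff _ _) (dif_neg h)).trans (map_zero _)).symm
  · change coeff X Y (dite (S X Y) _ _) = _
    split_ifs with h
    · exact hb X Y h
    · exact map_zero _

/-- Invariance under the twist carries the rows at level `l` to all other levels. -/
theorem eq_zero_of_ent (hd : d * d = 1) (l : ℤ) {f : TwistedExtension (s.linearize k) d}
    (h : ∀ (x : V) Y, ent ⟨x, l⟩ Y f = 0) : f = 0 := by
  refine ext_ent fun X Y => ?_
  obtain ⟨i, hi⟩ := exists_level (s := s) hd l X
  rw [map_zero, ← ent_zpow f i X Y]
  subst hi
  exact h _ _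

theorem finite_extension [Finite V] (hd : d * d = 1) :
    Module.Finite k (TwistedExtension (s.linearize k) d) := by
  let φ : TwistedExtension (s.linearize k) d →ₗ[k] (V → V → k) × (V → V → k) :=
    (LinearMap.pi fun x => LinearMap.pi fun y => ent ⟨x, 0⟩ ⟨y, 0⟩).prod
      (LinearMap.pi fun x => LinearMap.pi fun y => ent ⟨x, 0⟩ ⟨y, 1⟩)
  refine Module.Finite.of_injective φ ((injective_iff_map_eq_zero φ).2 fun f hf => ?_)
  refine eq_zero_of_ent hd 0 fun x ⟨y, l⟩ => ?_
  by_contra h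
  obtain ⟨hl, -⟩ | ⟨hl, -⟩ := rel_of_ent h
  · dsimp only at hl
    subst hl
    exact h (congrFun (congrFun (congrArg Prod.fst hf) x) y)
  · dsimp only at hl
    subst hl
    exact h (congrFun (congrFun (congrArg Prod.snd hf) x) y)

/-- The coefficients at the identities of the objects over `x` form a character. -/
noncomputable def vertexChar (hV' : HeightOne V) (x : V) :
    TwistedExtension (s.linearize k) d →ₐ[k] k :=
  AlgHom.ofLinearMap (ent ⟨x, 0⟩ ⟨x, 0⟩) (ent_one _) fun g f => by
    rw [ent_mul _ _ (rel_refl _), finsum_eq_single _ ⟨x, 0⟩, mul_comm]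
    -- A nonzero term needs morphisms x^[0] → Y → x^[0]. Levels never drop, so `Y` has level zero
    -- and paths in both directions, which forces `Y` to be x^[0].
    intro Y hY
    by_contra h
    have h1 := rel_of_ent (left_ne_zero_of_mul h)
    have h2 := rel_of_ent (right_ne_zero_of_mul h)
    obtain ⟨y, l⟩ := Y
    simp only [Rel] at h1 h2
    obtain ⟨l1, p1⟩ | ⟨l1, p1⟩ := h1 <;> obtain ⟨l2, p2⟩ | ⟨l2, p2⟩ := h2 <;> try omega
    exact hY (Repetition.ext (hV'.antisymm p2 p1) l1)

theorem vertexChar_apply (hV' : HeightOne V) (x : V) (f : TwistedExtension (s.linearize k) d) :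
    vertexChar hV' x f = ent ⟨x, 0⟩ ⟨x, 0⟩ f := rfl

theorem ent_self_eq_zero (hV' : HeightOne V) (hd : d * d = 1)
    {f : TwistedExtension (s.linearize k) d} (hf : ∀ x, vertexChar hV' x f = 0)
    (X : Repetition k (PathCategory k V)) : ent X X f = 0 := by
  obtain ⟨i, hi⟩ := exists_level (s := s) hd 0 X
  rw [← ent_zpow f i]
  have : (twistPerm s k d ^ i) X = ⟨((twistPerm s k d ^ i) X).base, 0⟩ := Repetition.ext rfl hi
  rw [this]
  exact hf _

/-- If `f` has a nonzero entry x^[0] → Y, then `Y` is related to x^[1]. For the `g` with coefficient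
one on the orbit of the pair (Y, x^[1]) and zero elsewhere, the form of `g * f` is exactly the
coefficient of that entry. -/
theorem frobeniusForm_nondeg [Fintype V] (hd : d * d = 1) (f : TwistedExtension (s.linearize k) d)
    (hf : ∀ g, frobeniusForm s k d (g * f) = 0) : f = 0 := by
  classical
  refine eq_zero_of_ent hd 0 fun x Y => ?_
  by_contra h
  have hrel := rel_of_ent h
  have hY : Rel Y ⟨x, 1⟩ := by
    obtain ⟨hl, p⟩ | ⟨hl, p⟩ := hrel
    · exact .inr ⟨by rw [hl, zero_add], p⟩
    · exact .inl ⟨by rw [hl, zero_add], p⟩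
  have hself : ∀ y : PathCategory k V, Rel (⟨y, 0⟩ : Repetition k (PathCategory k V)) ⟨y, 1⟩ :=
    fun y => .inr ⟨rfl, ⟨.nil⟩⟩
  obtain ⟨g, hg⟩ := exists_ent (s := s) (d := d)
    (fun P Q => ∃ i : ℤ, (twistPerm s k d ^ i) Y = P ∧ (twistPerm s k d ^ i) ⟨x, 1⟩ = Q)
    (by
      rintro _ _ ⟨i, rfl, rfl⟩
      exact (rel_zpow i _ _).2 hY)
    (fun P Q => by
      constructor
      · rintro ⟨i, h1, h2⟩
        refine ⟨-1 + i, ?_, ?_⟩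
        · rw [zpow_add, Equiv.Perm.mul_apply, h1]; simp
        · rw [zpow_add, Equiv.Perm.mul_apply, h2]; simp
      · rintro ⟨i, rfl, rfl⟩
        exact ⟨1 + i, by rw [zpow_one_add, Equiv.Perm.mul_apply],
          by rw [zpow_one_add, Equiv.Perm.mul_apply]⟩)
  -- Only the zeroth power of the twist preserves levels, so no other pair in this orbit ends at
  -- level one.
  have hS : ∀ (P : Repetition k (PathCategory k V)) (y : V),
      (∃ i : ℤ, (twistPerm s k d ^ i) Y = P ∧ (twistPerm s k d ^ i) ⟨x, 1⟩ = ⟨y, 1⟩) ↔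
        P = Y ∧ y = x := by
    refine fun P y => ⟨?_, fun h => ⟨0, h.1.symm, by rw [h.2]; rfl⟩⟩
    rintro ⟨i, rfl, h2⟩
    have h3 := level_zpow (s := s) (d := d) i (⟨x, 1⟩ : Repetition k (PathCategory k V))
    rw [h2] at h3
    have h4 : i * d * d = 0 := by
      rw [show i * d = 0 by dsimp only at h3; omega, zero_mul]
    rw [mul_assoc, hd, mul_one] at h4
    subst h4
    exact ⟨rfl, (congrArg Repetition.base h2).symm⟩
  refine h ((hf g).symm.trans ?_).symm
  rw [frobeniusForm_apply, Finset.sum_eq_single x]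
  · rw [ent_mul _ _ (hself x), finsum_eq_single _ Y, hg, if_pos ((hS _ _).2 ⟨rfl, rfl⟩), mul_one]
    intro P hP
    rw [hg, if_neg fun H => hP ((hS _ _).1 H).1, mul_zero]
  · intro y _ hy
    rw [ent_mul _ _ (hself y)]
    refine finsum_eq_zero_of_forall_eq_zero fun P => ?_
    rw [hg, if_neg fun H => hy ((hS _ _).1 H).2, mul_zero]
  · simp

/-- The orbits of the x^[0] partition the objects, since each orbit meets level zero exactly once.
-/
theorem completeOrthogonalIdempotents [Fintype V] (hd : d * d = 1) :
    CompleteOrthogonalIdempotents (fun x : V => vertexIdempotent (s.linearize k) d x) := by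
  classical
  have hinj : ∀ (x y : V) (X : Repetition k (PathCategory k V)),
      X ∈ OrbitAlgebra.orbit (twist (s.linearize k) d) ⟨x, 0⟩ →
      X ∈ OrbitAlgebra.orbit (twist (s.linearize k) d) ⟨y, 0⟩ → x = y := fun x y X h h' =>
    congrArg Repetition.base (eq_of_mem_orbit hd (h.trans _ _ _ (h'.symm _ _)) rfl)
  rw [CompleteOrthogonalIdempotents.iff_ortho_complete]
  constructor
  · intro x y hxy
    refine ext_ent fun X Y => ?_
    rw [ent_idempotent_mul, ent_idempotent, map_zero]
    split_ifs with h1 h2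
    · obtain ⟨rfl, h2⟩ := h2
      exact (hxy (hinj x y X h1 h2)).elim
    · rfl
    · rfl
  · refine ext_ent fun X Y => ?_
    refine (map_sum (ent X Y) (fun x : V => vertexIdempotent (s.linearize k) d x)
      Finset.univ).trans ?_
    simp only [ent_idempotent]
    by_cases h : X = Y
    · subst h
      obtain ⟨i, hi⟩ := exists_level (s := s) hd 0 X
      have hX : ∃ x : V, X ∈ OrbitAlgebra.orbit (twist (s.linearize k) d) ⟨x, 0⟩ := by
        refine ⟨((twistPerm s k d ^ i) X).base, (mem_orbit_iff _ _).2 ⟨-i, ?_⟩⟩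
        have : (twistPerm s k d ^ i) X = ⟨((twistPerm s k d ^ i) X).base, 0⟩ :=
          Repetition.ext rfl hi
        rw [← this, ← Equiv.Perm.mul_apply, ← zpow_add]
        simp
      obtain ⟨x, hx⟩ := hX
      rw [ent_one, Finset.sum_eq_single x, if_pos ⟨rfl, hx⟩]
      · exact fun y _ hy => if_neg fun H => hy (hinj _ _ X H.2 hx)
      · simp
    · rw [ent_apply, OrbitAlgebra.entry_one_ne h, map_zero]
      exact Finset.sum_eq_zero fun x _ => if_neg fun H => h H.1

theorem frobeniusData [Fintype V] (hV' : HeightOne V) (hd : d * d = 1) (π : Equiv.Perm V)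
    (hπ : ∀ x : V, (⟨π x, 1⟩ : Repetition k (PathCategory k V)) ∈
      OrbitAlgebra.orbit (twist (s.linearize k) d) ⟨x, 0⟩) :
    FrobeniusData k (fun x : V => vertexIdempotent (s.linearize k) d x) (vertexChar hV')
      (frobeniusForm s k d) π where
  finite := finite_extension hd
  complete := completeOrthogonalIdempotents hd
  char_self x := by
    classical
    rw [vertexChar_apply, ent_idempotent, if_pos ⟨rfl, .refl _⟩]
  mul_mul_eq_zero a b c ha hb hc := by
    refine ext_ent fun X W => ?_
    rw [map_zero]
    by_contra h
    have hXW := rel_of_ent h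
    rw [ent_mul _ _ hXW] at h
    obtain ⟨Y, hY⟩ := not_forall.1 (mt finsum_eq_zero_of_forall_eq_zero h)
    have hab := right_ne_zero_of_mul hY
    rw [ent_mul _ _ (rel_of_ent hab)] at hab
    obtain ⟨Z, hZ⟩ := not_forall.1 (mt finsum_eq_zero_of_forall_eq_zero hab)
    have h1 := left_ne_zero_of_mul hY
    have h2 := left_ne_zero_of_mul hZ
    have h3 := right_ne_zero_of_mul hZ
    rcases hV'.eq_of_rel (rel_of_ent h1) (rel_of_ent h2) (rel_of_ent h3) hXW with rfl | rfl | rfl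
    · exact h1 (ent_self_eq_zero hV' hd hc _)
    · exact h2 (ent_self_eq_zero hV' hd hb _)
    · exact h3 (ent_self_eq_zero hV' hd ha _)
  nondeg := frobeniusForm_nondeg hd
  twist x f := by
    classical
    simp only [frobeniusForm_apply, ent_idempotent_mul, ent_mul_idempotent]
    refine Finset.sum_congr rfl fun y _ => ?_
    -- Left multiplication by the idempotent of `x` tests the target y^[1], right multiplication by
    -- that of `π x` tests the source y^[0]; both keep only the summand `y = π x`.
    have h : (⟨y, 1⟩ : Repetition k (PathCategory k V)) ∈
        OrbitAlgebra.orbit (TwistedExt.twist (s.linearize k) d) ⟨x, 0⟩ ↔ y = π x := by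
      refine ⟨fun h => ?_, fun h => h ▸ hπ x⟩
      exact congrArg Repetition.base (eq_of_mem_orbit hd ((h.symm _ _).trans _ _ _ (hπ x)) rfl)
    have h' : (⟨y, 0⟩ : Repetition k (PathCategory k V)) ∈
        OrbitAlgebra.orbit (TwistedExt.twist (s.linearize k) d) ⟨π x, 0⟩ ↔ y = π x := by
      refine ⟨fun h => ?_, fun h => h ▸ .refl _⟩
      exact congrArg Repetition.base (eq_of_mem_orbit hd (h.symm _ _) rfl)
    simp only [h, h']

end Extension

/-! ### The quiver of the permutation is bipartite, and its Frobenius data -/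

section CycleQuiverPaths

variable {n : ℕ} {σ : Equiv.Perm (Fin n)} (D : CycleDecomposition σ)

instance : Fintype D.Vertex := inferInstanceAs (Fintype (Σ i : Fin D.m, Fin (D.t i)))

/-- The alternating directions make the quiver bipartite: counting from zero, no arrow enters an
even cycle or leaves an odd one. -/
theorem CycleDecomposition.even_odd_of_arrow {a b : D.Vertex} (f : a ⟶ b) :
    Even (a.1 : ℕ) ∧ ¬ Even (b.1 : ℕ) := by
  rcases (D.arrow_iff a b).1 ⟨f⟩ with ⟨h1, h2⟩ | ⟨h1, h2⟩
  · rw [← h1]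
    exact ⟨h2, by simpa [Nat.even_add_one] using h2⟩
  · rw [← h1]
    exact ⟨h2.add_one, by simpa using h2⟩

theorem CycleDecomposition.length_eq_zero {a b : D.Vertex} (p : Quiver.Path a b)
    (hb : Even (b.1 : ℕ)) : p.length = 0 := by
  cases p with
  | nil => rfl
  | cons p f => exact ((D.even_odd_of_arrow f).2 hb).elim

instance (a b : D.Vertex) : Subsingleton (Quiver.Path a b) := by
  -- A path that can be prolonged ends in an even cycle, hence is trivial; so all paths have length
  -- at most one.
  have key : ∀ {c : D.Vertex} (p : Quiver.Path a c) (f : c ⟶ b), p.length = 0 := fun p f =>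
    D.length_eq_zero p (D.even_odd_of_arrow f).1
  refine ⟨fun p q => ?_⟩
  cases p with
  | nil =>
    cases q with
    | nil => rfl
    | cons q f =>
      have := Quiver.Path.eq_of_length_zero q (key q f)
      subst this
      exact ((D.even_odd_of_arrow f).2 (D.even_odd_of_arrow f).1).elim
  | cons p f =>
    have hp := key p f
    obtain rfl := Quiver.Path.eq_of_length_zero p hp
    obtain rfl := Quiver.Path.eq_nil_of_length_zero p hp
    cases q with
    | nil => exact ((D.even_odd_of_arrow f).2 (D.even_odd_of_arrow f).1).elim
    | cons q g =>
      have hq := key q g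
      obtain rfl := Quiver.Path.eq_of_length_zero q hq
      obtain rfl := Quiver.Path.eq_nil_of_length_zero q hq
      rw [Subsingleton.elim f g]

theorem CycleDecomposition.heightOne : HeightOne D.Vertex := by
  intro a b c p q
  cases q with
  | nil => exact .inr rfl
  | cons q f =>
    have hq := D.length_eq_zero q (D.even_odd_of_arrow f).1
    obtain rfl := Quiver.Path.eq_of_length_zero q hq
    exact .inl (Quiver.Path.eq_of_length_zero p (D.length_eq_zero p (D.even_odd_of_arrow f).1))

/-- The permutation `σ` of the vertices. -/
noncomputable def CycleDecomposition.vertexPerm : Equiv.Perm D.Vertex :=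
  Equiv.ofBijective _ D.quiverAut.obj_bijective

/-- The bijection between `{1, …, n}` and the vertices. -/
def CycleDecomposition.vertexEquiv : Fin n ≃ D.Vertex := D.x.symm

theorem CycleDecomposition.conj_vertexPerm :
    (D.vertexEquiv.trans D.vertexPerm).trans D.vertexEquiv.symm = σ := by
  ext a
  have := D.x_quiverAut (D.x.symm a)
  rw [D.x.apply_symm_apply] at this
  exact congrArg Fin.val this

theorem CycleDecomposition.conj_vertexPerm_symm :
    (D.vertexEquiv.trans D.vertexPerm.symm).trans D.vertexEquiv.symm = σ.symm :=
  congrArg Equiv.symm D.conj_vertexPerm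

/-- The twist carries x^[0] to (σ x)^[1], so the permutation of the form is `σ`. -/
theorem CycleDecomposition.frobeniusData (k : Type u) [Field k] : FrobeniusData k
    (D.idempotent k 1) (vertexChar D.heightOne ∘ D.vertexEquiv)
    (frobeniusForm D.quiverAut k 1) σ := by
  have h := (TwistedExt.frobeniusData (k := k) (s := D.quiverAut) (d := 1) D.heightOne rfl
    D.vertexPerm fun x => .rel _ _ rfl).reindex D.vertexEquiv
  rw [D.conj_vertexPerm] at h
  exact h

/-- Here the twist carries (σ⁻¹ x)^[1] to x^[0], so the permutation of the form is `σ.symm`, and its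
inverse, the one for left modules, is `σ`. -/
theorem CycleDecomposition.frobeniusData_neg (k : Type u) [Field k] : FrobeniusData k
    (D.idempotent k (-1)) (vertexChar D.heightOne ∘ D.vertexEquiv)
    (frobeniusForm D.quiverAut k (-1)) σ.symm := by
  have h := (TwistedExt.frobeniusData (k := k) (s := D.quiverAut) (d := -1) D.heightOne rfl
    D.vertexPerm.symm fun x => .symm _ _ (.rel _ _ (Repetition.ext
      (D.vertexPerm.apply_symm_apply x) rfl))).reindex D.vertexEquiv
  rw [D.conj_vertexPerm_symm] at h
  exact h

end CycleQuiverPaths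

end TwistedExt

theorem mainTheorem12 (k : Type u) [Field k] {n : ℕ} (σ : Equiv.Perm (Fin n))
    (D : TwistedExt.CycleDecomposition σ) :
    (TwistedExt.IsSelfInjectiveAlgebra k (D.Extension k 1) ∧
      Ring.jacobson (D.Extension k 1) ^ 3 = ⊥ ∧
      TwistedExt.IsBasicSystem (D.idempotent k 1) ∧
      TwistedExt.IsNakayamaPermutation (D.idempotent k 1) σ) ∧
    (TwistedExt.IsSelfInjectiveAlgebra k (D.Extension k (-1)) ∧
      Ring.jacobson (D.Extension k (-1)) ^ 3 = ⊥ ∧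
      TwistedExt.IsBasicSystem (D.idempotent k (-1)) ∧
      TwistedExt.IsLeftNakayamaPermutation (D.idempotent k (-1)) σ) := by
  have h := D.frobeniusData k
  have h' := D.frobeniusData_neg k
  exact ⟨⟨h.isSelfInjectiveAlgebra, h.jacobson_pow, h.isBasicSystem, h.isNakayamaPermutation⟩,
    h'.isSelfInjectiveAlgebra, h'.jacobson_pow, h'.isBasicSystem, h'.isLeftNakayamaPermutation⟩
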